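/- Let $\Delta \ge 3$ and let $T_\Delta$ be the infinite $\Delta$-regular tree, each of whose vertices holds an independent uniformly random infinite bit string. A *uniform local algorithm* $\mathcal A$ is a (measurable) function of the isomorphism type of a finite neighbourhood $B(v,t)$ with the strings of its vertices; its value is either $\emptyset$ (no answer yet) or one marked half-edge at $v$. The *coding radius* $R_{\mathcal A}(v)\in\mathbb N\cup\{\infty\}$ is the least $t$ for which the value on $B(v,t)$ is not $\emptyset$, and the output at $v$ is the value on $B(v,R_{\mathcal A}(v))$; if it marks the edge $\{v,u\}$, we say that $v$ grabs $\{v,u\}$ and that $u$ is the parent of $v$. Let $\mathcal T^{\leftarrow}(v)$ be the set of all vertices, including $v$, from which $v$ is reached by passing repeatedly from a vertex to its parent. The output is a *one-ended spanning forest* if every vertex grabs exactly one incident edge, no edge is grabbed by both of its endpoints, and $\mathcal T^{\leftarrow}(v)$ is finite for every $v$. Let $R(v)\in\mathbb N\cup\{\infty\}$ be the least $t$ such that $B(v,t)$ with its strings determines $\mathcal T^{\leftarrow}(v)$, that is, $\mathcal T^{\leftarrow}(v)\subseteq B(v,t)$ and $\mathcal T^{\leftarrow}(v)$ stays the same under every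 change of the strings outside $B(v,t)$. Theorem. For every $\Delta\ge 3$ there are a uniform local algorithm $\mathcal A$ and functions $t_1,t_2:\mathbb R\to\mathbb N$ with $t_i(\varepsilon)=O\big((\log(1/\varepsilon))^{k_i}\big)$ as $\varepsilon\to 0^+$ for some $k_i\in\mathbb N$, such that on $T_\Delta$: 1. almost surely, the output of $\mathcal A$ is a one-ended spanning forest; 2. $P(R_{\mathcal A}(v)\ge t_1(\varepsilon))\le\varepsilon$ for every vertex $v$ and every $0<\varepsilon<1$; 3. $P(R(v)> t_2(\varepsilon))\le\varepsilon$ for every vertex $v$ and every $0<\varepsilon<1$. -/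

import Mathlib

open MeasureTheory Filter Topology Asymptotics

universe u

noncomputable section

namespace OneEnded

/-- The infinite random string held by a vertex. -/
abbrev Seed : Type := ℕ → Bool

/-- Independent fair bits. -/
def seedMeasure : Measure Seed :=
  Measure.infinitePi fun _ : ℕ => (PMF.uniformOfFintype Bool).toMeasure

instance : IsProbabilityMeasure seedMeasure := by
  unfold seedMeasure; infer_instance

/-- Every vertex receives an independent random string. -/
def iidMeasure (V : Type u) : Measure (V → Seed) :=
  Measure.infinitePi fun _ : V => seedMeasure

instance (V : Type u) : IsProbabilityMeasure (iidMeasure V) := by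
  unfold iidMeasure; infer_instance

/-- The vertex set of the `t`-hop neighbourhood `B(v, t)`. -/
def ball {V : Type u} (G : SimpleGraph V) (v : V) (t : ℕ) : Set V :=
  {w | G.edist v w ≤ t}

/-- The centre of `B(v, t)`. -/
def ballCenter {V : Type u} (G : SimpleGraph V) (v : V) (t : ℕ) : ball G v t :=
  ⟨v, by simp [ball]⟩

/-- A uniform local algorithm whose output at a vertex is one marked half-edge at this vertex:
a function of the isomorphism type of a neighbourhood. The arguments of `out` are the
neighbourhood (a graph `H` on `W`), its centre, its radius, and the strings of its vertices; the
value `none` is the symbol `∅` (no answer yet), and `some w` is the half-edge at the centre that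
leads to its neighbour `w`. The algorithm does not see the names of the vertices (`out_iso`). -/
structure UniformAlgorithm where
  out : (W : Type u) → SimpleGraph W → W → ℕ → (W → Seed) → Option W
  out_adj : ∀ (W : Type u) (H : SimpleGraph W) (r : W) (t : ℕ) (x : W → Seed) (w : W),
    out W H r t x = some w → H.Adj r w
  out_iso : ∀ (W W' : Type u) (H : SimpleGraph W) (H' : SimpleGraph W') (φ : H ≃g H') (r : W)
    (t : ℕ) (x : W' → Seed),
    out W' H' (φ r) t x = (out W H r t fun w => x (φ w)).map φ
  out_measurable : ∀ (W : Type u) [Finite W] (H : SimpleGraph W) (r : W) (t : ℕ) (o : Option W),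
    MeasurableSet {x : W → Seed | out W H r t x = o}

namespace UniformAlgorithm

variable {V : Type u}

/-- The answer of the algorithm when it is applied to `B(v, t)`. -/
def answer (A : UniformAlgorithm.{u}) (G : SimpleGraph V) (ω : V → Seed) (v : V) (t : ℕ) :
    Option (ball G v t) :=
  A.out (ball G v t) (G.induce (ball G v t)) (ballCenter G v t) t fun w => ω w

/-- The coding radius `R_A(v)`: the least `t` such that the answer on `B(v, t)` is not `∅`
(`⊤` if there is none). -/
def codingRadius (A : UniformAlgorithm.{u}) (G : SimpleGraph V) (ω : V → Seed) (v : V) : ℕ∞ :=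
  ⨅ t ∈ {t : ℕ | A.answer G ω v t ≠ none}, (t : ℕ∞)

open Classical in
/-- The output of the algorithm on `G`: the vertex `v` uses its answer on `B(v, t)` with `t` the
coding radius. The value is the other endpoint of the edge that `v` grabs, or `none` if the
coding radius is infinite. -/
def run (A : UniformAlgorithm.{u}) (G : SimpleGraph V) (ω : V → Seed) (v : V) : Option V :=
  if h : ∃ t : ℕ, A.answer G ω v t ≠ none then
    (A.answer G ω v (Nat.find h)).map Subtype.val
  else none

end UniformAlgorithm

variable {V : Type u}

/-- Edge grabbing: every vertex grabs exactly one incident edge, and no edge is grabbed by both of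
its endpoints. `p v = some u` means that `v` grabs the edge `{v, u}`. -/
def IsEdgeGrab (G : SimpleGraph V) (p : V → Option V) : Prop :=
  (∀ v, ∃ u, p v = some u ∧ G.Adj v u) ∧ ∀ v u, p v = some u → p u ≠ some v

/-- The vertices of the subtree `T^←(v)` with root `v`: all `w` from which `v` is reached by
following grabbed edges from child to parent. -/
def subtree (p : V → Option V) (v : V) : Set V :=
  {w | Relation.ReflTransGen (fun a b => p a = some b) w v}

/-- A one-ended spanning forest. -/
def IsOneEndedSpanningForest (G : SimpleGraph V) (p : V → Option V) : Prop :=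
  IsEdgeGrab G p ∧ ∀ v, (subtree p v).Finite

/-- The labelled neighbourhood `B(v, t)` determines `T^←(v)`: the subtree lies in the
neighbourhood and is the same for all strings outside the neighbourhood. -/
def DeterminesSubtree (A : UniformAlgorithm.{u}) (G : SimpleGraph V) (ω : V → Seed) (v : V)
    (t : ℕ) : Prop :=
  subtree (A.run G ω) v ⊆ ball G v t ∧
    ∀ ω' : V → Seed, (∀ w ∈ ball G v t, ω' w = ω w) →
      subtree (A.run G ω') v = subtree (A.run G ω) v

/-- `R(v)`: the least radius that allows `v` to compute `T^←(v)`. -/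
def subtreeRadius (A : UniformAlgorithm.{u}) (G : SimpleGraph V) (ω : V → Seed) (v : V) : ℕ∞ :=
  ⨅ t ∈ {t : ℕ | DeterminesSubtree A G ω v t}, (t : ℕ∞)

/-- `t(ε) = O(poly log 1/ε)` as `ε` tends to `0`. -/
def IsPolyLog (t : ℝ → ℕ) : Prop :=
  ∃ k : ℕ, (fun ε => (t ε : ℝ)) =O[𝓝[>] 0] fun ε => Real.log (1 / ε) ^ k

end OneEnded

end

noncomputable section

namespace OneEnded

/-! ### Balls -/

section Balls

variable {V : Type u} {G : SimpleGraph V}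

/-! Write b for `scale B i`; it is cubed from one level to the next. A decreasing sequence of random
vertex sets, `level`, starts with all vertices. In level i, every oriented edge looks for branching
vertices ahead of it along paths of length at most 64b² and selects one of least label, its target.
The targets are the centers, and level i + 1 is the union of the paths from each center to its own
targets. It is again branchy: ahead of every edge a branching vertex is soon met
(`IsBranchy.refine`).

The levels thin out very fast. Ahead of each edge there are at least 2^(8b) - 1 branching vertices
(`IsBranchy.exists_finset_ahead`), while a vertex is low, hence preferred as a target, with
probability 2^(-4b). So a target is almost always low, and centers have density about 2^(-4b). The
paths starting at one center cover O(b²) vertices except on a rare event. Mass transport, based on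
automorphisms that exchange two vertices (`exists_iso_swap`), turns this into the density bound
2^(-b) for level i + 1 (`measure_level_succ_le_half_pow`). Membership in it is nevertheless decided
within a radius polynomial in b (`levelRadius_le`).

Each level is recovered from the next one by thickening (`IsBranchy.thicken_refine`). Peeling off
the layers one by one gives the `flow`, in which every vertex that leaves has a neighbour that stays
(`exists_adj_of_mem_flow`); such a neighbour is its parent. Exit times strictly increase from child
to parent, so no edge is grabbed twice, and the subtree of a vertex lies within a distance bounded
by its exit time (`subtree_subset`). A vertex outlives level i with probability at most 2^(-b),
whereas all radii up to that time are polynomial in b, which gives polylogarithmic tails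
(`exists_radius_bound`). -/

lemma mem_ball_iff {v w : V} {t : ℕ} : w ∈ ball G v t ↔ ∃ p : G.Walk v w, p.length ≤ t := by
  constructor
  · intro h
    have h' : G.edist v w ≤ t := h
    obtain ⟨p, hp⟩ := SimpleGraph.exists_walk_of_edist_ne_top
      (ne_top_of_le_ne_top (ENat.natCast_ne_top t) h')
    exact ⟨p, by rw [← hp] at h'; exact_mod_cast h'⟩
  · rintro ⟨p, hp⟩
    exact (SimpleGraph.edist_le p).trans (by exact_mod_cast hp)

lemma self_mem_ball (v : V) (t : ℕ) : v ∈ ball G v t := by simp [ball]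

lemma mem_ball_comm {v w : V} {t : ℕ} : w ∈ ball G v t ↔ v ∈ ball G w t := by
  simp [ball, SimpleGraph.edist_comm]

lemma ball_mono {v : V} {s t : ℕ} (h : s ≤ t) : ball G v s ⊆ ball G v t := fun w hw =>
  le_trans (show G.edist v w ≤ s from hw) (by exact_mod_cast h)

lemma mem_ball_trans {a b c : V} {s t : ℕ} (hb : b ∈ ball G a s) (hc : c ∈ ball G b t) :
    c ∈ ball G a (s + t) := by
  obtain ⟨p, hp⟩ := mem_ball_iff.1 hb
  obtain ⟨q, hq⟩ := mem_ball_iff.1 hc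
  exact mem_ball_iff.2 ⟨p.append q, by simp; omega⟩

lemma ball_subset_ball {a b : V} {s t r : ℕ} (hb : b ∈ ball G a s) (h : s + t ≤ r) :
    ball G b t ⊆ ball G a r := fun _ hc => ball_mono h (mem_ball_trans hb hc)

lemma mem_ball_of_adj {a b : V} (h : G.Adj a b) : b ∈ ball G a 1 :=
  mem_ball_iff.2 ⟨h.toWalk, by simp⟩

lemma mem_ball_of_mem_support {a b x : V} (p : G.Walk a b) (hx : x ∈ p.support) :
    x ∈ ball G a p.length := by
  classical
  exact mem_ball_iff.2 ⟨p.takeUntil x hx, p.length_takeUntil_le_length hx⟩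

end Balls

/-! ### Refinement of a vertex set -/

section Refine

variable {V : Type u}

/-- A path of length at most `t` inside `X`. -/
def IsArc (G : SimpleGraph V) (X : Set V) (t : ℕ) {a b : V} (p : G.Walk a b) : Prop :=
  p.IsPath ∧ p.length ≤ t ∧ ∀ x ∈ p.support, x ∈ X

/-- `w` is reached by an arc in `X` that starts with the edge from `s` to `u`. -/
def Ahead (G : SimpleGraph V) (X : Set V) (t : ℕ) (s u w : V) : Prop :=
  ∃ (h : G.Adj s u) (q : G.Walk u w), IsArc G X t (.cons h q)

/-- The vertices of `X` with at least three neighbours in `X`. -/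
def branching (G : SimpleGraph V) (X : Set V) : Set V :=
  {w | w ∈ X ∧ ∃ a ∈ X, ∃ b ∈ X, ∃ c ∈ X, G.Adj w a ∧ G.Adj w b ∧ G.Adj w c ∧
    a ≠ b ∧ a ≠ c ∧ b ≠ c}

/-- `w` has the least label among the branching vertices ahead of the edge from `s` to `u`. -/
def IsTarget (G : SimpleGraph V) (X : Set V) (l : V → WithTop ℕ) (t : ℕ) (s u w : V) : Prop :=
  w ∈ branching G X ∧ Ahead G X t s u w ∧
    ∀ w' ∈ branching G X, Ahead G X t s u w' → l w ≤ l w'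

/-- The vertices that are targets. -/
def centers (G : SimpleGraph V) (X : Set V) (l : V → WithTop ℕ) (t : ℕ) : Set V :=
  {w | ∃ s u, IsTarget G X l t s u w}

/-- The union of the arcs that lead from the center `s` to its targets. -/
def trail (G : SimpleGraph V) (X : Set V) (l : V → WithTop ℕ) (t : ℕ) (s : V) : Set V :=
  {v | s ∈ centers G X l t ∧ ∃ u w, IsTarget G X l t s u w ∧
    ∃ (h : G.Adj s u) (q : G.Walk u w), IsArc G X t (.cons h q) ∧
      v ∈ (SimpleGraph.Walk.cons h q).support}

/-- The sparser set that consists of all trails. -/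
def refine (G : SimpleGraph V) (X : Set V) (l : V → WithTop ℕ) (t : ℕ) : Set V :=
  {v | ∃ s, v ∈ trail G X l t s}

/-- The vertices of `X` from which `Y` is reached by at most `k` steps inside `X`. -/
def thicken (G : SimpleGraph V) (X Y : Set V) : ℕ → Set V
  | 0 => Y
  | k + 1 => {v | v ∈ thicken G X Y k ∨ v ∈ X ∧ ∃ u ∈ thicken G X Y k, G.Adj v u}

variable {G : SimpleGraph V} {X Y : Set V} {l : V → WithTop ℕ} {t : ℕ}

lemma IsArc.support_subset_ball {a b : V} {p : G.Walk a b} (hp : IsArc G X t p) :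
    ∀ x ∈ p.support, x ∈ ball G a t := fun _ hx =>
  ball_mono hp.2.1 (mem_ball_of_mem_support p hx)

lemma Ahead.mem_ball {s u w : V} (h : Ahead G X t s u w) : w ∈ ball G s t := by
  obtain ⟨h, q, hq⟩ := h
  exact hq.support_subset_ball _ (SimpleGraph.Walk.end_mem_support _)

lemma Ahead.snd_mem_ball {s u w : V} (h : Ahead G X t s u w) : u ∈ ball G s t := by
  obtain ⟨h, q, hq⟩ := h
  exact hq.support_subset_ball _ (by simp)

lemma Ahead.start_mem {s u w : V} (h : Ahead G X t s u w) : s ∈ X := by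
  obtain ⟨h, q, hq⟩ := h
  exact hq.2.2 _ (by simp)

lemma Ahead.snd_mem {s u w : V} (h : Ahead G X t s u w) : u ∈ X := by
  obtain ⟨h, q, hq⟩ := h
  exact hq.2.2 _ (by simp)

lemma mem_ball_of_mem_trail {s v : V} (h : v ∈ trail G X l t s) : v ∈ ball G s t := by
  obtain ⟨-, u, w, -, h, q, hq, hv⟩ := h
  exact hq.support_subset_ball _ hv

lemma trail_subset {s : V} : trail G X l t s ⊆ X := by
  rintro v ⟨-, u, w, -, h, q, hq, hv⟩
  exact hq.2.2 _ hv

lemma refine_subset : refine G X l t ⊆ X := by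
  rintro v ⟨s, hs⟩
  exact trail_subset hs

lemma thicken_subset (h : Y ⊆ X) (k : ℕ) : thicken G X Y k ⊆ X := by
  induction k with
  | zero => exact h
  | succ k ih =>
    rintro v (hv | hv)
    · exact ih hv
    · exact hv.1

lemma thicken_mono {j k : ℕ} (h : j ≤ k) : thicken G X Y j ⊆ thicken G X Y k := by
  induction k, h using Nat.le_induction with
  | base => exact subset_rfl
  | succ k _ ih => exact fun v hv => Or.inl (ih hv)

end Refine

/-! ### Transfer along graph embeddings -/

section Transfer

open SimpleGraph

variable {V W : Type u} {G : SimpleGraph V} {H : SimpleGraph W}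

/-- Supports are compared instead of walks: whether a walk is an arc depends only on its support,
and no walk has to be transported along equalities of endpoints. -/
lemma exists_walk_lift (φ : H ↪g G) {y z : V} (q : G.Walk y z) :
    ∀ a, φ a = y → (∀ x ∈ q.support, x ∈ Set.range φ) →
      ∃ b, φ b = z ∧ ∃ p : H.Walk a b, p.support.map φ = q.support := by
  induction q with
  | nil => exact fun a ha _ => ⟨a, ha, .nil, by simp [ha]⟩
  | @cons y u z h q ih =>
    intro a ha hr
    obtain ⟨c, hc⟩ := hr u (by simp)
    obtain ⟨b, hb, p, hp⟩ := ih c hc fun x hx => hr x (by simp [hx])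
    have hac : H.Adj a c := by
      rw [← φ.map_adj_iff, ha, hc]
      exact h
    exact ⟨b, hb, .cons hac p, by simp [ha, hp]⟩

/-- The image of `φ` contains `D`, and the sets `X` and `X'` correspond to each other in `D`. -/
structure Matches (φ : H ↪g G) (D : Set V) (X : Set W) (X' : Set V) : Prop where
  subset_range : D ⊆ Set.range φ
  mem_iff : ∀ w, φ w ∈ D → (w ∈ X ↔ φ w ∈ X')

variable {φ : H ↪g G} {D : Set V} {X Y : Set W} {X' Y' : Set V} {l : W → WithTop ℕ}
  {l' : V → WithTop ℕ} {t : ℕ}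

lemma Matches.isArc_iff (hM : Matches φ D X X') {a b : W} {y z : V} (p : H.Walk a b)
    (q : G.Walk y z) (hpq : p.support.map φ = q.support) (hD : ∀ x ∈ q.support, x ∈ D) :
    IsArc H X t p ↔ IsArc G X' t q := by
  have h1 : p.IsPath ↔ q.IsPath := by
    rw [Walk.isPath_def, Walk.isPath_def, ← hpq, List.nodup_map_iff φ.injective]
  have h2 : p.length = q.length := by
    have := congrArg List.length hpq
    simpa using this
  have h3 : (∀ x ∈ p.support, x ∈ X) ↔ ∀ x ∈ q.support, x ∈ X' := by
    rw [← hpq] at hD ⊢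
    simp only [List.mem_map, forall_exists_index, and_imp, forall_apply_eq_imp_iff₂] at hD ⊢
    exact forall₂_congr fun x hx => hM.mem_iff x (hD x hx)
  rw [IsArc, IsArc, h1, h2, h3]

lemma mem_of_mem_support_of_length_le {s : V} (hD : ball G s t ⊆ D) {w : V} {p : G.Walk s w}
    (hp : p.length ≤ t) {x : V} (hx : x ∈ p.support) : x ∈ D :=
  hD (ball_mono hp (mem_ball_of_mem_support p hx))

lemma Matches.ahead_iff (hM : Matches φ D X X') {s : W} (hD : ball G (φ s) t ⊆ D) {u w : W} :
    Ahead H X t s u w ↔ Ahead G X' t (φ s) (φ u) (φ w) := by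
  constructor
  · rintro ⟨h, q, hq⟩
    refine ⟨φ.map_adj_iff.2 h, q.map φ.toHom, ?_⟩
    have hs : (Walk.cons h q).support.map φ =
        (Walk.cons (φ.map_adj_iff.2 h) (q.map φ.toHom)).support := by
      simp [Walk.support_map]
    refine (hM.isArc_iff _ _ hs fun x hx => mem_of_mem_support_of_length_le hD ?_ hx).1 hq
    simpa using hq.2.1
  · rintro ⟨h, q, hq⟩
    have hx : ∀ x ∈ (Walk.cons h q).support, x ∈ D :=
      fun x hx => mem_of_mem_support_of_length_le hD hq.2.1 hx
    obtain ⟨b, hb, p, hp⟩ := exists_walk_lift φ q u rfl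
      fun x hx' => hM.subset_range (hx x (by simp [hx']))
    obtain rfl := φ.injective hb
    exact ⟨φ.map_adj_iff.1 h, p, (hM.isArc_iff _ _ (by simp [hp]) hx).2 hq⟩

lemma Matches.ahead_range (hM : Matches φ D X X') {s : W} (hD : ball G (φ s) t ⊆ D) {u w : V}
    (h : Ahead G X' t (φ s) u w) : (∃ u', φ u' = u) ∧ ∃ w', φ w' = w :=
  ⟨hM.subset_range (hD h.snd_mem_ball), hM.subset_range (hD h.mem_ball)⟩

lemma Matches.mem_branching_iff (hM : Matches φ D X X') {w : W} (hD : ball G (φ w) 1 ⊆ D) :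
    w ∈ branching H X ↔ φ w ∈ branching G X' := by
  have hmem : ∀ {a}, H.Adj w a → (a ∈ X ↔ φ a ∈ X') := fun ha =>
    hM.mem_iff _ (hD (mem_ball_of_adj (φ.map_adj_iff.2 ha)))
  have hrange : ∀ {a}, G.Adj (φ w) a → ∃ a', φ a' = a := fun ha =>
    hM.subset_range (hD (mem_ball_of_adj ha))
  refine and_congr (hM.mem_iff _ (hD (self_mem_ball _ _))) ⟨?_, ?_⟩
  · rintro ⟨a, ha, b, hb, c, hc, wa, wb, wc, ab, ac, bc⟩
    exact ⟨φ a, (hmem wa).1 ha, φ b, (hmem wb).1 hb, φ c, (hmem wc).1 hc, φ.map_adj_iff.2 wa,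
      φ.map_adj_iff.2 wb, φ.map_adj_iff.2 wc, φ.injective.ne ab, φ.injective.ne ac,
      φ.injective.ne bc⟩
  · rintro ⟨a, ha, b, hb, c, hc, wa, wb, wc, ab, ac, bc⟩
    obtain ⟨a, rfl⟩ := hrange wa
    obtain ⟨b, rfl⟩ := hrange wb
    obtain ⟨c, rfl⟩ := hrange wc
    rw [φ.map_adj_iff] at wa wb wc
    exact ⟨a, (hmem wa).2 ha, b, (hmem wb).2 hb, c, (hmem wc).2 hc, wa, wb, wc,
      fun h => ab (h ▸ rfl), fun h => ac (h ▸ rfl), fun h => bc (h ▸ rfl)⟩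

/-- An arc may end at distance `t`, and whether its end is branching depends on the neighbours of
that end; hence the radius `t + 1`. -/
lemma Matches.isTarget_iff (hM : Matches φ D X X') (hl : ∀ w, φ w ∈ D → l w = l' (φ w)) {s : W}
    (hD : ball G (φ s) (t + 1) ⊆ D) {u w : W} :
    IsTarget H X l t s u w ↔ IsTarget G X' l' t (φ s) (φ u) (φ w) := by
  have hD' : ball G (φ s) t ⊆ D := (ball_mono (Nat.le_succ t)).trans hD
  have key : ∀ {w}, Ahead H X t s u w →
      (w ∈ branching H X ↔ φ w ∈ branching G X') ∧ l w = l' (φ w) := by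
    intro w hw
    have hb := ((hM.ahead_iff hD').1 hw).mem_ball
    exact ⟨hM.mem_branching_iff ((ball_subset_ball hb le_rfl).trans hD), hl _ (hD' hb)⟩
  constructor
  · rintro ⟨h1, h2, h3⟩
    refine ⟨(key h2).1.1 h1, (hM.ahead_iff hD').1 h2, fun w' hw' ha => ?_⟩
    obtain ⟨-, w', rfl⟩ := hM.ahead_range hD' ha
    rw [← hM.ahead_iff hD'] at ha
    rw [← (key h2).2, ← (key ha).2]
    exact h3 _ ((key ha).1.2 hw') ha
  · rintro ⟨h1, h2, h3⟩
    rw [← hM.ahead_iff hD'] at h2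
    refine ⟨(key h2).1.2 h1, h2, fun w' hw' ha => ?_⟩
    rw [(key h2).2, (key ha).2]
    exact h3 _ ((key ha).1.1 hw') ((hM.ahead_iff hD').1 ha)

/-- A vertex that selects `w` lies within `t` of it, and its selection is settled within a further
`t + 1`. -/
lemma Matches.mem_centers_iff (hM : Matches φ D X X') (hl : ∀ w, φ w ∈ D → l w = l' (φ w))
    {w : W} (hD : ball G (φ w) (2 * t + 1) ⊆ D) :
    w ∈ centers H X l t ↔ φ w ∈ centers G X' l' t := by
  constructor
  · rintro ⟨s, u, h⟩
    refine ⟨φ s, φ u, (hM.isTarget_iff hl ?_).1 h⟩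
    obtain ⟨h, q, hq⟩ := h.2.1
    have hb : φ s ∈ ball G (φ w) t := mem_ball_comm.1 <| mem_ball_iff.2
      ⟨(Walk.cons h q).map φ.toHom, by simpa using hq.2.1⟩
    exact (ball_subset_ball hb (by omega)).trans hD
  · rintro ⟨s, u, h⟩
    have hb : s ∈ ball G (φ w) t := mem_ball_comm.1 h.2.1.mem_ball
    obtain ⟨s, rfl⟩ := hM.subset_range (hD (ball_mono (by omega) hb))
    have hD' : ball G (φ s) (t + 1) ⊆ D := (ball_subset_ball hb (by omega)).trans hD
    obtain ⟨u, rfl⟩ := hM.subset_range (hD' (ball_mono (Nat.le_succ t) h.2.1.snd_mem_ball))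
    exact ⟨s, u, (hM.isTarget_iff hl hD').2 h⟩

lemma Matches.mem_trail_iff (hM : Matches φ D X X') (hl : ∀ w, φ w ∈ D → l w = l' (φ w))
    {s v : W} (hD : ball G (φ s) (2 * t + 1) ⊆ D) :
    v ∈ trail H X l t s ↔ φ v ∈ trail G X' l' t (φ s) := by
  have hD1 : ball G (φ s) (t + 1) ⊆ D := (ball_mono (by omega)).trans hD
  have hD2 : ball G (φ s) t ⊆ D := (ball_mono (by omega)).trans hD
  refine and_congr (hM.mem_centers_iff hl hD) ⟨?_, ?_⟩
  · rintro ⟨u, w, ht, h, q, hq, hv⟩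
    refine ⟨φ u, φ w, (hM.isTarget_iff hl hD1).1 ht, φ.map_adj_iff.2 h, q.map φ.toHom, ?_, ?_⟩
    · refine (hM.isArc_iff (Walk.cons h q) _ (by simp [Walk.support_map])
        fun x hx => mem_of_mem_support_of_length_le hD2 ?_ hx).1 hq
      simpa using hq.2.1
    · simp only [Walk.support_cons, Walk.support_map, List.mem_cons] at hv ⊢
      rcases hv with rfl | hv
      · exact Or.inl rfl
      · exact Or.inr (List.mem_map_of_mem hv)
  · rintro ⟨u, w, ht, h, q, hq, hv⟩
    have hx : ∀ x ∈ (Walk.cons h q).support, x ∈ D :=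
      fun x hx => mem_of_mem_support_of_length_le hD2 hq.2.1 hx
    obtain ⟨u, rfl⟩ := hM.subset_range (hx u (by simp))
    obtain ⟨w, rfl, p, hp⟩ := exists_walk_lift φ q u rfl
      fun x hx' => hM.subset_range (hx x (by simp [hx']))
    refine ⟨u, w, (hM.isTarget_iff hl hD1).2 ht, φ.map_adj_iff.1 h, p,
      (hM.isArc_iff _ _ (by simp [hp]) hx).2 hq, ?_⟩
    rw [Walk.support_cons, List.mem_cons] at hv ⊢
    rcases hv with hv | hv
    · exact Or.inl (φ.injective hv)
    · rw [← hp, List.mem_map] at hv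
      obtain ⟨v', hv', h⟩ := hv
      exact Or.inr (φ.injective h ▸ hv')

lemma Matches.mem_refine_iff (hM : Matches φ D X X') (hl : ∀ w, φ w ∈ D → l w = l' (φ w))
    {v : W} (hD : ball G (φ v) (3 * t + 1) ⊆ D) :
    v ∈ refine H X l t ↔ φ v ∈ refine G X' l' t := by
  constructor
  · rintro ⟨s, hs⟩
    refine ⟨φ s, (hM.mem_trail_iff hl ?_).1 hs⟩
    obtain ⟨p, hp⟩ := mem_ball_iff.1 (mem_ball_of_mem_trail hs)
    have hb : φ s ∈ ball G (φ v) t := mem_ball_comm.1 <| mem_ball_iff.2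
      ⟨p.map φ.toHom, by simpa using hp⟩
    exact (ball_subset_ball hb (by omega)).trans hD
  · rintro ⟨s, hs⟩
    have hb : s ∈ ball G (φ v) t := mem_ball_comm.1 (mem_ball_of_mem_trail hs)
    obtain ⟨s, rfl⟩ := hM.subset_range (hD (ball_mono (by omega) hb))
    exact ⟨s, (hM.mem_trail_iff hl ((ball_subset_ball hb (by omega)).trans hD)).2 hs⟩

lemma Matches.mem_thicken_iff (hM : Matches φ D X X') (hY : Matches φ D Y Y') (k : ℕ) :
    ∀ {v : W}, ball G (φ v) k ⊆ D → (v ∈ thicken H X Y k ↔ φ v ∈ thicken G X' Y' k) := by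
  induction k with
  | zero => exact fun hD => hY.mem_iff _ (hD (self_mem_ball _ _))
  | succ k ih =>
    intro v hD
    have hn : ∀ {u}, G.Adj (φ v) (φ u) →
        (u ∈ thicken H X Y k ↔ φ u ∈ thicken G X' Y' k) := fun hu =>
      ih ((ball_subset_ball (mem_ball_of_adj hu) (by omega)).trans hD)
    refine or_congr (ih ((ball_mono (Nat.le_succ k)).trans hD))
      (and_congr (hM.mem_iff _ (hD (self_mem_ball _ _))) ⟨?_, ?_⟩)
    · rintro ⟨u, hu, h⟩
      have h' := φ.map_adj_iff.2 h
      exact ⟨φ u, (hn h').1 hu, h'⟩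
    · rintro ⟨u, hu, h⟩
      obtain ⟨u, rfl⟩ := hM.subset_range (hD (ball_mono (by omega) (mem_ball_of_adj h)))
      exact ⟨u, (hn h).2 hu, φ.map_adj_iff.1 h⟩

end Transfer

/-! ### Growth of branching subsets of trees -/

section Growth

open SimpleGraph

variable {V : Type u} {G : SimpleGraph V} {X Y : Set V} {l : V → WithTop ℕ} {t ρ : ℕ}

/-- Every vertex of `X` has a neighbour in `X`, and a branching vertex is met within distance `ρ`
ahead of every edge in `X`. -/
structure IsBranchy (G : SimpleGraph V) (X : Set V) (ρ : ℕ) : Prop where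
  exists_adj : ∀ v ∈ X, ∃ u ∈ X, G.Adj v u
  exists_ahead : ∀ v ∈ X, ∀ u ∈ X, G.Adj v u → ∃ w ∈ branching G X, Ahead G X ρ v u w

lemma IsArc.mono {s t : ℕ} (h : s ≤ t) {a b : V} {p : G.Walk a b} (hp : IsArc G X s p) :
    IsArc G X t p := ⟨hp.1, hp.2.1.trans h, hp.2.2⟩

lemma Ahead.mono {s t : ℕ} (h : s ≤ t) {a b c : V} (hp : Ahead G X s a b c) :
    Ahead G X t a b c := by
  obtain ⟨h', q, hq⟩ := hp
  exact ⟨h', q, hq.mono h⟩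

lemma IsBranchy.mono {s t : ℕ} (h : s ≤ t) (hX : IsBranchy G X s) : IsBranchy G X t where
  exists_adj := hX.exists_adj
  exists_ahead v hv u hu hvu := by
    obtain ⟨w, hw, ha⟩ := hX.exists_ahead v hv u hu hvu
    exact ⟨w, hw, ha.mono h⟩

/-- In an acyclic graph a walk that never turns back along its last edge is a path, so only the
junction has to be checked. -/
lemma isPath_append (hG : G.IsAcyclic) {a b c d : V} {p : G.Walk a b} {h : G.Adj b c}
    {q : G.Walk c d} (hp : p.IsPath) (hq : (Walk.cons h q).IsPath) (hne : c ≠ p.penultimate) :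
    (p.append (.cons h q)).IsPath := by
  rw [hG.isPath_iff_isChain] at hp hq ⊢
  rw [Walk.edges_append, List.isChain_append]
  refine ⟨hp, hq, fun e he e' he' => ?_⟩
  simp only [Walk.edges_cons, List.head?_cons, Option.mem_def, Option.some.injEq] at he'
  subst he'
  rintro rfl
  have hp' : ¬p.Nil := by
    intro hn
    have : p.edges = [] := by simpa [Walk.edges_eq_nil] using hn
    simp [this] at he
  have hmem : s(b, c) ∈ p.edges := List.mem_of_getLast? he
  have hcs : c ∈ p.support := p.snd_mem_support_of_mem_edges hmem
  exact hne (hG.eq_penultimate_of_adj_end ((hG.isPath_iff_isChain p).2 hp) h hcs)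

lemma ahead_append (hG : G.IsAcyclic) {k j : ℕ} {s u w c y : V} {h : G.Adj s u}
    {q : G.Walk u w} (hq : IsArc G X k (.cons h q)) (hy : Ahead G X j w c y)
    (hc : c ≠ (Walk.cons h q).penultimate) : Ahead G X (k + j) s u y := by
  obtain ⟨h', r, hr⟩ := hy
  refine ⟨h, q.append (.cons h' r), ?_, ?_, ?_⟩
  · exact isPath_append hG hq.1 hr.1 hc
  · have h1 := hq.2.1
    have h2 := hr.2.1
    simp at h1 h2 ⊢
    omega
  · intro x hx
    rw [← Walk.cons_append, Walk.mem_support_append_iff] at hx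
    exact hx.elim (hq.2.2 x) (hr.2.2 x)

lemma Ahead.ne {s u w : V} (h : Ahead G X t s u w) : s ≠ w := by
  obtain ⟨h, q, hq⟩ := h
  rintro rfl
  have := hq.1
  rw [Walk.cons_isPath_iff] at this
  exact this.2 q.end_mem_support

lemma Ahead.snd_unique (hG : G.IsAcyclic) {s u u' w : V} {t t' : ℕ} (h : Ahead G X t s u w)
    (h' : Ahead G X t' s u' w) : u = u' := by
  obtain ⟨h, q, hq⟩ := h
  obtain ⟨h', q', hq'⟩ := h'
  have := congrArg Subtype.val <| (hG.subsingleton_path s w).elim ⟨_, hq.1⟩ ⟨_, hq'.1⟩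
  simpa using congrArg Walk.snd this

/-- A branching vertex has two neighbours in `X` other than a given vertex. -/
lemma exists_pair_of_mem_branching {w : V} (hw : w ∈ branching G X) (x : V) :
    ∃ a ∈ X, ∃ b ∈ X, G.Adj w a ∧ G.Adj w b ∧ a ≠ b ∧ a ≠ x ∧ b ≠ x := by
  obtain ⟨-, a, ha, b, hb, c, hc, wa, wb, wc, ab, ac, bc⟩ := hw
  by_cases h1 : a = x
  · exact ⟨b, hb, c, hc, wb, wc, bc, h1 ▸ ab.symm, h1 ▸ ac.symm⟩
  by_cases h2 : b = x
  · exact ⟨a, ha, c, hc, wa, wc, ac, h1, h2 ▸ bc.symm⟩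
  exact ⟨a, ha, b, hb, wa, wb, ab, h1, h2⟩

/-- The number of branching vertices ahead of an edge grows exponentially. -/
lemma IsBranchy.exists_finset_ahead (hG : G.IsAcyclic) (hX : IsBranchy G X ρ) (k : ℕ) :
    ∀ v ∈ X, ∀ u ∈ X, G.Adj v u → ∃ F : Finset V, 2 ^ k ≤ F.card + 1 ∧
      ∀ w ∈ F, w ∈ branching G X ∧ Ahead G X (k * ρ) v u w := by
  classical
  induction k with
  | zero => exact fun v _ u _ _ => ⟨∅, by simp, by simp⟩
  | succ k ih =>
    intro v hv u hu huv
    -- The branching vertex `w` has two continuations that do not turn back. The families ahead of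
    -- them are disjoint because paths from `w` are unique; together with `w` the count goes from n
    -- to 2n + 1.
    obtain ⟨w, hw, h, q, hq⟩ := hX.exists_ahead v hv u hu huv
    obtain ⟨a, ha, b, hb, wa, wb, ab, ax, bx⟩ :=
      exists_pair_of_mem_branching hw (Walk.cons h q).penultimate
    obtain ⟨F, hF, hF'⟩ := ih w hw.1 a ha wa
    obtain ⟨F₂, hF₂, hF₂'⟩ := ih w hw.1 b hb wb
    have hdisj : Disjoint F F₂ := Finset.disjoint_left.2 fun y hy hy' =>
      ab ((hF' y hy).2.snd_unique hG (hF₂' y hy').2)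
    have hwF : w ∉ F ∪ F₂ := by
      intro hmem
      rcases Finset.mem_union.1 hmem with hy | hy
      · exact (hF' w hy).2.ne rfl
      · exact (hF₂' w hy).2.ne rfl
    refine ⟨insert w (F ∪ F₂), ?_, fun y hy => ?_⟩
    · rw [Finset.card_insert_of_notMem hwF, Finset.card_union_of_disjoint hdisj, pow_succ]
      omega
    · have hk : (k + 1) * ρ = ρ + k * ρ := by ring
      rw [hk]
      rcases Finset.mem_insert.1 hy with rfl | hy
      · exact ⟨hw, h, q, hq.mono (by omega)⟩
      rcases Finset.mem_union.1 hy with hy | hy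
      · exact ⟨(hF' y hy).1, ahead_append hG hq (hF' y hy).2 ax⟩
      · exact ⟨(hF₂' y hy).1, ahead_append hG hq (hF₂' y hy).2 bx⟩

lemma IsBranchy.exists_isTarget (hX : IsBranchy G X t) (l : V → WithTop ℕ) {v u : V}
    (hv : v ∈ X) (hu : u ∈ X) (h : G.Adj v u) : ∃ w, IsTarget G X l t v u w := by
  obtain ⟨w, hw, ha⟩ := hX.exists_ahead v hv u hu h
  have hne : {w | w ∈ branching G X ∧ Ahead G X t v u w}.Nonempty := ⟨w, hw, ha⟩
  let s := (InvImage.wf l wellFounded_lt).min _ hne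
  have hs : s ∈ {w | w ∈ branching G X ∧ Ahead G X t v u w} := WellFounded.min_mem _ _ hne
  exact ⟨s, hs.1, hs.2, fun w' hw' ha' => not_lt.1 fun hlt =>
    (InvImage.wf l wellFounded_lt).not_lt_min _ (show w' ∈ {w | w ∈ branching G X ∧ Ahead G X t v u w} from ⟨hw', ha'⟩) hlt⟩

lemma centers_subset_branching : centers G X l t ⊆ branching G X := by
  rintro w ⟨s, u, h⟩
  exact h.1

lemma IsTarget.mem_refine {s u w : V} (hs : s ∈ centers G X l t) (h : IsTarget G X l t s u w)
    {h' : G.Adj s u} {q : G.Walk u w} (hq : IsArc G X t (.cons h' q)) :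
    ∀ x ∈ (Walk.cons h' q).support, x ∈ refine G X l t := fun _ hx =>
  ⟨s, hs, u, w, h, h', q, hq, hx⟩

lemma IsBranchy.mem_refine_of_adj_center (hX : IsBranchy G X t) {s u : V}
    (hs : s ∈ centers G X l t) (hu : u ∈ X) (h : G.Adj s u) :
    s ∈ refine G X l t ∧ u ∈ refine G X l t := by
  obtain ⟨w, hw⟩ := hX.exists_isTarget l (centers_subset_branching hs).1 hu h
  obtain ⟨h', q, hq⟩ := hw.2.1
  have := hw.mem_refine hs hq
  exact ⟨this _ (by simp), this _ (by simp)⟩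

/-- A center sends an arc along each of its edges in `X`, so none of these edges is lost in the
refinement. -/
lemma IsBranchy.centers_subset_branching_refine (hX : IsBranchy G X t) :
    centers G X l t ⊆ branching G (refine G X l t) := by
  intro s hs
  obtain ⟨-, a, ha, b, hb, c, hc, wa, wb, wc, hne⟩ := centers_subset_branching hs
  exact ⟨(hX.mem_refine_of_adj_center hs ha wa).1, a, (hX.mem_refine_of_adj_center hs ha wa).2, b,
    (hX.mem_refine_of_adj_center hs hb wb).2, c, (hX.mem_refine_of_adj_center hs hc wc).2,
    wa, wb, wc, hne⟩

lemma IsTarget.mem_centers {s u w : V} (h : IsTarget G X l t s u w) : w ∈ centers G X l t :=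
  ⟨s, u, h⟩

lemma exists_arc_of_mem_refine {v : V} (hv : v ∈ refine G X l t) :
    ∃ s ∈ centers G X l t, ∃ w ∈ centers G X l t, ∃ (p₁ : G.Walk s v) (p₂ : G.Walk v w),
      IsArc G (refine G X l t) t (p₁.append p₂) := by
  obtain ⟨s, hs, u, w, hw, h, q, hq, hv⟩ := hv
  obtain ⟨p₁, p₂, hp⟩ := Walk.mem_support_iff_exists_append.1 hv
  refine ⟨s, hs, w, hw.mem_centers, p₁, p₂, ?_⟩
  rw [← hp]
  exact ⟨hq.1, hq.2.1, hw.mem_refine hs hq⟩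

/-- The second vertex `u` of the edge lies on an arc between two centers. The first vertex `v`
cannot lie on both halves of this arc, so the half that avoids `v` continues the edge to a center,
which is branching. -/
lemma IsBranchy.refine (hX : IsBranchy G X t) : IsBranchy G (refine G X l t) (t + 1) where
  exists_adj v hv := by
    obtain ⟨s, hs, w, hw, p₁, p₂, hp⟩ := exists_arc_of_mem_refine hv
    cases p₂ with
    | nil =>
      obtain ⟨-, a, ha, -, -, -, -, h, -⟩ := hX.centers_subset_branching_refine hw
      exact ⟨a, ha, h⟩
    | @cons _ u _ h q => exact ⟨u, hp.2.2 u (by simp [Walk.mem_support_append_iff]), h⟩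
  exists_ahead v hv u hu hvu := by
    obtain ⟨s, hs, w, hw, p₁, p₂, hp⟩ := exists_arc_of_mem_refine hu
    have hlen := hp.2.1
    rw [Walk.length_append] at hlen
    have hmem₁ : ∀ x ∈ p₁.support, x ∈ OneEnded.refine G X l t := fun x hx =>
      hp.2.2 x (by simp [Walk.mem_support_append_iff, hx])
    have hmem₂ : ∀ x ∈ p₂.support, x ∈ OneEnded.refine G X l t := fun x hx =>
      hp.2.2 x (by simp [Walk.mem_support_append_iff, hx])
    by_cases h₁ : v ∈ p₁.support
    · refine ⟨w, hX.centers_subset_branching_refine hw, hvu, p₂, ?_, ?_, ?_⟩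
      · refine (Walk.cons_isPath_iff _ _).2 ⟨hp.1.of_append_right, fun h₂ => ?_⟩
        exact hp.1.ne_of_mem_support_of_append hvu.ne h₁ h₂ rfl
      · simp; omega
      · simpa using ⟨hv, hmem₂⟩
    · refine ⟨s, hX.centers_subset_branching_refine hs, hvu, p₁.reverse, ?_, ?_, ?_⟩
      · refine (Walk.cons_isPath_iff _ _).2 ⟨hp.1.of_append_left.reverse, by simpa using h₁⟩
      · simp; omega
      · simpa using ⟨hv, hmem₁⟩

lemma mem_thicken_of_walk {v w : V} (p : G.Walk v w) (hp : ∀ x ∈ p.support, x ∈ X) (hw : w ∈ Y) :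
    v ∈ thicken G X Y p.length := by
  induction p with
  | nil => exact hw
  | @cons v u w h p ih =>
    exact Or.inr ⟨hp v (by simp), u, ih (fun x hx => hp x (by simp [hx])) hw, h⟩

/-- Every vertex of `X` has an edge in `X`, hence a target, which is a center and is reached by an
arc inside `X`. This lets the flow pass from one level to the next without a gap. -/
lemma IsBranchy.thicken_refine (hX : IsBranchy G X t) :
    thicken G X (OneEnded.refine G X l t) t = X := by
  refine (thicken_subset refine_subset t).antisymm fun v hv => ?_
  obtain ⟨u, hu, h⟩ := hX.exists_adj v hv
  obtain ⟨w, hw⟩ := hX.exists_isTarget l hv hu h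
  obtain ⟨h', q, hq⟩ := hw.2.1
  exact thicken_mono hq.2.1 (mem_thicken_of_walk _ hq.2.2
    (hX.centers_subset_branching_refine hw.mem_centers).1)

lemma isBranchy_univ {Δ : ℕ} (hΔ : 3 ≤ Δ) [G.LocallyFinite] (hreg : G.IsRegularOfDegree Δ)
    (hρ : 1 ≤ ρ) : IsBranchy G Set.univ ρ := by
  have hbr : ∀ v, v ∈ branching G Set.univ := by
    intro v
    have : 2 < (G.neighborFinset v).card := by
      rw [G.card_neighborFinset_eq_degree, hreg v]
      omega
    obtain ⟨a, b, c, ha, hb, hc, hne⟩ := Finset.two_lt_card_iff.1 this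
    rw [mem_neighborFinset] at ha hb hc
    exact ⟨trivial, a, trivial, b, trivial, c, trivial, ha, hb, hc, hne⟩
  constructor
  · intro v _
    obtain ⟨-, a, -, -, -, -, -, h, -⟩ := hbr v
    exact ⟨a, trivial, h⟩
  · intro v _ u _ h
    exact ⟨u, hbr u, h, .nil, by simp [h.ne], by simpa using hρ, by simp⟩

end Growth

/-! ### Automorphisms of regular trees -/

section Swap

open SimpleGraph

variable {V : Type u} {G : SimpleGraph V}

lemma exists_adj_closer (hG : G.Connected) {a x : V} (h : a ≠ x) :
    ∃ b, G.Adj a b ∧ G.dist a x = G.dist b x + 1 := by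
  obtain ⟨p, hp⟩ := hG.exists_walk_length_eq_dist a x
  cases p with
  | nil => exact absurd rfl h
  | @cons _ b _ hab q =>
    refine ⟨b, hab, ?_⟩
    have h1 := dist_le q
    have h2 := hG.dist_triangle (u := a) (v := b) (w := x)
    rw [dist_eq_one_iff_adj.2 hab] at h2
    simp at hp
    omega

lemma closer_unique (hG : G.IsTree) {a b c x : V} (hb : G.Adj a b) (hc : G.Adj a c)
    (hbx : G.dist a x = G.dist b x + 1) (hcx : G.dist a x = G.dist c x + 1) : b = c := by
  obtain ⟨p, hp⟩ := hG.connected.exists_walk_length_eq_dist b x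
  obtain ⟨q, hq⟩ := hG.connected.exists_walk_length_eq_dist c x
  have h1 : (Walk.cons hb p).IsPath := Walk.isPath_of_length_eq_dist _ (by simp; omega)
  have h2 : (Walk.cons hc q).IsPath := Walk.isPath_of_length_eq_dist _ (by simp; omega)
  have := congrArg Subtype.val <| (hG.isAcyclic.subsingleton_path a x).elim ⟨_, h1⟩ ⟨_, h2⟩
  simpa using congrArg Walk.snd this

/-- `z` lies between `x` and `y`. -/
def Between (G : SimpleGraph V) (x z y : V) : Prop := G.dist x z + G.dist z y = G.dist x y

lemma Between.symm {x y z : V} (h : Between G x z y) : Between G y z x := by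
  unfold Between at *
  rw [G.dist_comm, add_comm, G.dist_comm, h, G.dist_comm]

lemma between_of_closer (hG : G.IsTree) {a b x z : V} (hb : G.Adj a b)
    (hbx : G.dist a x = G.dist b x + 1) (hz : Between G a z x) (hza : z ≠ a) :
    Between G b z x := by
  unfold Between at *
  obtain ⟨c, hc, hcz⟩ := exists_adj_closer hG.connected hza.symm
  have h1 := hG.connected.dist_triangle (u := c) (v := z) (w := x)
  have h2 := hG.connected.dist_triangle (u := a) (v := c) (w := x)
  rw [dist_eq_one_iff_adj.2 hc] at h2
  obtain rfl := closer_unique hG hb hc hbx (by omega)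
  omega

/-- A set of pairs that is the graph of an isometry between convex sets. -/
structure IsPartialIsometry (G : SimpleGraph V) (F : Set (V × V)) : Prop where
  dist_eq : ∀ p ∈ F, ∀ q ∈ F, G.dist p.1 q.1 = G.dist p.2 q.2
  convex_fst : ∀ p ∈ F, ∀ q ∈ F, ∀ z, Between G p.1 z q.1 → ∃ r ∈ F, r.1 = z
  convex_snd : ∀ p ∈ F, ∀ q ∈ F, ∀ z, Between G p.2 z q.2 → ∃ r ∈ F, r.2 = z

/-- In a tree the distance changes by exactly one along an edge; if it decreased, `a'` would lie
between `a` and `x`, against convexity. -/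
lemma dist_eq_succ_of_notMem (hG : G.IsTree) {S : Set V}
    (hS : ∀ x ∈ S, ∀ y ∈ S, ∀ z, Between G x z y → z ∈ S) {a a' x : V} (ha : a ∈ S)
    (ha' : a' ∉ S) (h : G.Adj a a') (hx : x ∈ S) : G.dist a' x = G.dist a x + 1 := by
  rcases hG.dist_eq_dist_add_one_of_adj x h with h1 | h1
  · refine absurd (hS a ha x hx a' ?_) ha'
    unfold Between
    rw [dist_eq_one_iff_adj.2 h, G.dist_comm (u := a') (v := x), G.dist_comm (u := a) (v := x)]
    omega
  · rw [G.dist_comm (u := a') (v := x), G.dist_comm (u := a) (v := x), h1]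

lemma IsPartialIsometry.eq_iff (hG : G.IsTree) {F : Set (V × V)} (hF : IsPartialIsometry G F)
    {p q : V × V} (hp : p ∈ F) (hq : q ∈ F) : p.1 = q.1 ↔ p.2 = q.2 := by
  rw [← hG.connected.dist_eq_zero_iff, ← hG.connected.dist_eq_zero_iff, hF.dist_eq p hp q hq]

/-- By convexity, paths from the new points into the old sets enter through `p.1` and `p.2`, so
corresponding distances both grow by one. -/
lemma IsPartialIsometry.insert (hG : G.IsTree) {F : Set (V × V)} (hF : IsPartialIsometry G F)
    {p : V × V} (hp : p ∈ F) {a' b' : V} (ha : G.Adj p.1 a') (hb : G.Adj p.2 b')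
    (ha' : ∀ q ∈ F, q.1 ≠ a') (hb' : ∀ q ∈ F, q.2 ≠ b') :
    IsPartialIsometry G (insert (a', b') F) := by
  have d1 : ∀ q ∈ F, G.dist a' q.1 = G.dist p.1 q.1 + 1 := by
    refine fun q hq => dist_eq_succ_of_notMem hG (S := Prod.fst '' F) ?_ ⟨p, hp, rfl⟩ ?_ ha
      ⟨q, hq, rfl⟩
    · rintro _ ⟨x, hx, rfl⟩ _ ⟨y, hy, rfl⟩ z hz
      exact hF.convex_fst x hx y hy z hz
    · rintro ⟨q, hq, h⟩
      exact ha' q hq h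
  have d2 : ∀ q ∈ F, G.dist b' q.2 = G.dist p.2 q.2 + 1 := by
    refine fun q hq => dist_eq_succ_of_notMem hG (S := Prod.snd '' F) ?_ ⟨p, hp, rfl⟩ ?_ hb
      ⟨q, hq, rfl⟩
    · rintro _ ⟨x, hx, rfl⟩ _ ⟨y, hy, rfl⟩ z hz
      exact hF.convex_snd x hx y hy z hz
    · rintro ⟨q, hq, h⟩
      exact hb' q hq h
  have d3 : ∀ q ∈ F, G.dist a' q.1 = G.dist b' q.2 := fun q hq => by
    rw [d1 q hq, d2 q hq, hF.dist_eq p hp q hq]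
  have c1 : ∀ q ∈ F, ∀ z, Between G a' z q.1 → ∃ r ∈ Insert.insert (a', b') F, r.1 = z := by
    intro q hq z hz
    by_cases hza : z = a'
    · exact ⟨(a', b'), Set.mem_insert _ _, hza.symm⟩
    obtain ⟨r, hr, h⟩ := hF.convex_fst p hp q hq z
      (between_of_closer hG ha.symm (d1 q hq) hz hza)
    exact ⟨r, Set.mem_insert_of_mem _ hr, h⟩
  have c2 : ∀ q ∈ F, ∀ z, Between G b' z q.2 → ∃ r ∈ Insert.insert (a', b') F, r.2 = z := by
    intro q hq z hz
    by_cases hza : z = b'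
    · exact ⟨(a', b'), Set.mem_insert _ _, hza.symm⟩
    obtain ⟨r, hr, h⟩ := hF.convex_snd p hp q hq z
      (between_of_closer hG hb.symm (d2 q hq) hz hza)
    exact ⟨r, Set.mem_insert_of_mem _ hr, h⟩
  have c0 : ∀ {x z : V}, Between G x z x → z = x := by
    intro x z h
    unfold Between at h
    rw [G.dist_self] at h
    exact (hG.connected.dist_eq_zero_iff.1 (by omega : G.dist z x = 0))
  refine ⟨?_, ?_, ?_⟩
  · rintro q (rfl | hq) r (rfl | hr)
    · simp
    · exact d3 r hr
    · rw [G.dist_comm, G.dist_comm (u := q.2)]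
      exact d3 q hq
    · exact hF.dist_eq q hq r hr
  · rintro q (rfl | hq) r (rfl | hr) z hz
    · exact ⟨(a', b'), Set.mem_insert _ _, (c0 hz).symm⟩
    · exact c1 r hr z hz
    · exact c1 q hq z hz.symm
    · obtain ⟨s, hs, h⟩ := hF.convex_fst q hq r hr z hz
      exact ⟨s, Set.mem_insert_of_mem _ hs, h⟩
  · rintro q (rfl | hq) r (rfl | hr) z hz
    · exact ⟨(a', b'), Set.mem_insert _ _, (c0 hz).symm⟩
    · exact c2 r hr z hz
    · exact c2 q hq z hz.symm
    · obtain ⟨s, hs, h⟩ := hF.convex_snd q hq r hr z hz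
      exact ⟨s, Set.mem_insert_of_mem _ hs, h⟩

/-- A connected set of vertices that contains all neighbours is everything. -/
lemma forall_of_adj_closed (hG : G.Connected) {P : V → Prop} {a : V} (ha : P a)
    (h : ∀ x y, G.Adj x y → P x → P y) (b : V) : P b := by
  obtain ⟨p⟩ := hG.preconnected a b
  induction p with
  | nil => exact ha
  | cons hxy _ ih => exact ih (h _ _ hxy ha)

/-- A maximal partial isometry of a regular tree is defined everywhere. -/
lemma IsPartialIsometry.fst_surjective (hG : G.IsTree) [G.LocallyFinite] {Δ : ℕ}
    (hreg : G.IsRegularOfDegree Δ) {F : Set (V × V)}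
    (hF : Maximal (IsPartialIsometry G) F) (hne : F.Nonempty) (x : V) :
    ∃ p ∈ F, p.1 = x := by
  classical
  obtain ⟨p₀, hp₀⟩ := hne
  refine forall_of_adj_closed hG.connected (P := fun x => ∃ p ∈ F, p.1 = x)
    ⟨p₀, hp₀, rfl⟩ ?_ x
  rintro _ a' ha ⟨p, hp, rfl⟩
  by_contra! hcon
  by_cases hb : ∃ b', G.Adj p.2 b' ∧ ∀ q ∈ F, q.2 ≠ b'
  · obtain ⟨b', hb, hb'⟩ := hb
    have := hF.2 (hF.1.insert hG hp ha hb hcon hb') (Set.subset_insert _ _)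
    exact hcon _ (this (Set.mem_insert _ _)) rfl
  -- Otherwise every neighbour of `p.2` is already an image. Its preimages are neighbours of `p.1`
  -- other than `a'`, so `p.2` would have smaller degree than `p.1`.
  · push Not at hb
    choose g hg hgb using hb
    have hlt : (G.neighborFinset p.2).card < (G.neighborFinset p.1).card := by
      rw [← Finset.card_attach]
      refine (Finset.card_le_card_of_injOn
        (fun b => (g b.1 ((mem_neighborFinset _ _ _).1 b.2)).1) (t := (G.neighborFinset p.1).erase a')
        ?_ ?_).trans_lt ?_
      · intro b _
        have hadj := (mem_neighborFinset _ _ _).1 b.2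
        rw [Finset.mem_coe, Finset.mem_erase, mem_neighborFinset]
        refine ⟨hcon _ (hg _ hadj), ?_⟩
        rw [← dist_eq_one_iff_adj, hF.1.dist_eq p hp _ (hg _ hadj), hgb, dist_eq_one_iff_adj]
        exact hadj
      · intro b _ c _ h
        have := (hF.1.eq_iff hG (hg _ _) (hg _ _)).1 h
        rw [hgb, hgb] at this
        exact Subtype.ext this
      · exact Finset.card_erase_lt_of_mem ((mem_neighborFinset _ _ _).2 ha)
    simp only [card_neighborFinset_eq_degree] at hlt
    rw [hreg, hreg] at hlt
    exact lt_irrefl _ hlt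

lemma dist_getVert_add_le (hG : G.Connected) {s v : V} (p : G.Walk s v) (i k : ℕ) :
    G.dist (p.getVert i) (p.getVert (i + k)) ≤ k := by
  induction k with
  | zero => simp
  | succ k ih =>
    have h1 := hG.dist_triangle (u := p.getVert i) (v := p.getVert (i + k))
      (w := p.getVert (i + (k + 1)))
    have h2 : G.dist (p.getVert (i + k)) (p.getVert (i + (k + 1))) ≤ 1 := by
      by_cases h : i + k < p.length
      · exact (dist_eq_one_iff_adj.2 (p.adj_getVert_succ h)).le
      · rw [p.getVert_of_length_le (by omega), p.getVert_of_length_le (by omega)]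
        simp
    omega

lemma dist_getVert (hG : G.Connected) {s v : V} {p : G.Walk s v} (hp : p.length = G.dist s v)
    {i j : ℕ} (hij : i ≤ j) (hj : j ≤ p.length) : G.dist (p.getVert i) (p.getVert j) = j - i := by
  have h1 := dist_getVert_add_le hG p 0 i
  have h2 := dist_getVert_add_le hG p i (j - i)
  have h3 := dist_getVert_add_le hG p j (p.length - j)
  rw [Nat.add_sub_cancel' hij] at h2
  rw [Nat.add_sub_cancel' hj, p.getVert_length] at h3
  simp only [zero_add, p.getVert_zero] at h1
  have h4 := hG.dist_triangle (u := s) (v := p.getVert i) (w := v)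
  have h5 := hG.dist_triangle (u := p.getVert i) (v := p.getVert j) (w := v)
  omega

lemma exists_getVert_of_between (hG : G.IsTree) {s v z : V} {p : G.Walk s v}
    (hp : p.length = G.dist s v) (hz : Between G s z v) :
    ∃ i ≤ p.length, p.getVert i = z := by
  obtain ⟨q, hq⟩ := hG.connected.exists_walk_length_eq_dist s z
  obtain ⟨r, hr⟩ := hG.connected.exists_walk_length_eq_dist z v
  unfold Between at hz
  have h1 : (q.append r).IsPath := Walk.isPath_of_length_eq_dist _ (by simp; omega)
  have h2 : p.IsPath := Walk.isPath_of_length_eq_dist _ hp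
  have := congrArg Subtype.val <| (hG.isAcyclic.subsingleton_path s v).elim ⟨_, h1⟩ ⟨_, h2⟩
  have hmem : z ∈ p.support := by
    rw [← show q.append r = p from this, Walk.mem_support_append_iff]
    exact Or.inl q.end_mem_support
  obtain ⟨n, hn, hle⟩ := Walk.mem_support_iff_exists_getVert.1 hmem
  exact ⟨n, hle, hn⟩

/-- Reversing a geodesic exchanges its ends; extending this map to the whole tree gives
`exists_iso_swap`. -/
lemma isPartialIsometry_reverse (hG : G.IsTree) {s v : V} {p : G.Walk s v}
    (hp : p.length = G.dist s v) :
    IsPartialIsometry G {q | ∃ i ≤ p.length, q = (p.getVert i, p.getVert (p.length - i))} := by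
  have hd : ∀ i ≤ p.length, ∀ j ≤ p.length,
      G.dist (p.getVert i) (p.getVert j) = (j - i) + (i - j) := by
    intro i hi j hj
    rcases le_total i j with h | h
    · rw [dist_getVert hG.connected hp h hj]; omega
    · rw [G.dist_comm, dist_getVert hG.connected hp h hi]; omega
  have hb : ∀ i ≤ p.length, ∀ j ≤ p.length, ∀ z, Between G (p.getVert i) z (p.getVert j) →
      Between G s z v := by
    have main : ∀ i j, i ≤ j → j ≤ p.length → ∀ z, Between G (p.getVert i) z (p.getVert j) →
      Between G s z v := by
      intro i j hij hj z hz
      have h1 := dist_getVert hG.connected hp (Nat.zero_le i) (hij.trans hj)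
      have h2 := dist_getVert hG.connected hp hij hj
      have h3 := dist_getVert hG.connected hp hj le_rfl
      rw [p.getVert_zero] at h1
      rw [p.getVert_length] at h3
      have h4 := hG.connected.dist_triangle (u := s) (v := p.getVert i) (w := z)
      have h5 := hG.connected.dist_triangle (u := z) (v := p.getVert j) (w := v)
      have h6 := hG.connected.dist_triangle (u := s) (v := z) (w := v)
      unfold Between at *
      omega
    intro i hi j hj z hz
    rcases le_total i j with h | h
    · exact main i j h hj z hz
    · exact main j i h hi z hz.symm
  refine ⟨?_, ?_, ?_⟩
  · rintro _ ⟨i, hi, rfl⟩ _ ⟨j, hj, rfl⟩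
    rw [hd i hi j hj, hd _ (by omega) _ (by omega)]
    omega
  · rintro _ ⟨i, hi, rfl⟩ _ ⟨j, hj, rfl⟩ z hz
    obtain ⟨k, hk, rfl⟩ := exists_getVert_of_between hG hp (hb i hi j hj z hz)
    exact ⟨_, ⟨k, hk, rfl⟩, rfl⟩
  · rintro _ ⟨i, hi, rfl⟩ _ ⟨j, hj, rfl⟩ z hz
    obtain ⟨k, hk, rfl⟩ := exists_getVert_of_between hG hp (hb _ (by omega) _ (by omega) z hz)
    exact ⟨_, ⟨p.length - k, by omega, rfl⟩, by simp [Nat.sub_sub_self hk]⟩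

/-- Any two vertices of a regular tree are exchanged by an automorphism. -/
theorem exists_iso_swap (hG : G.IsTree) [G.LocallyFinite] {Δ : ℕ}
    (hreg : G.IsRegularOfDegree Δ) (s v : V) : ∃ φ : G ≃g G, φ s = v ∧ φ v = s := by
  classical
  obtain ⟨p, hp⟩ := hG.connected.exists_walk_length_eq_dist s v
  -- Each condition on a partial isometry involves two pairs at a time, so the union of a chain is
  -- again one.
  obtain ⟨F, hF₀, hF⟩ := zorn_subset_nonempty {F | IsPartialIsometry G F} (fun c hc hchain _ => by
    have hdir : ∀ x ∈ ⋃₀ c, ∀ y ∈ ⋃₀ c, ∃ F ∈ c, x ∈ F ∧ y ∈ F := by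
      rintro x ⟨A, hA, hx⟩ y ⟨B, hB, hy⟩
      rcases hchain.total hA hB with h | h
      · exact ⟨B, hB, h hx, hy⟩
      · exact ⟨A, hA, hx, h hy⟩
    refine ⟨⋃₀ c, ⟨fun x hx y hy => ?_, fun x hx y hy z hz => ?_, fun x hx y hy z hz => ?_⟩,
      fun A hA => Set.subset_sUnion_of_mem hA⟩
    · obtain ⟨A, hA, hxA, hyA⟩ := hdir x hx y hy
      exact (hc hA).dist_eq x hxA y hyA
    · obtain ⟨A, hA, hxA, hyA⟩ := hdir x hx y hy
      obtain ⟨r, hr, h⟩ := (hc hA).convex_fst x hxA y hyA z hz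
      exact ⟨r, ⟨A, hA, hr⟩, h⟩
    · obtain ⟨A, hA, hxA, hyA⟩ := hdir x hx y hy
      obtain ⟨r, hr, h⟩ := (hc hA).convex_snd x hxA y hyA z hz
      exact ⟨r, ⟨A, hA, hr⟩, h⟩) _ (isPartialIsometry_reverse hG hp)
  have hs : (s, v) ∈ F := hF₀ ⟨0, Nat.zero_le _, by simp⟩
  have hv : (v, s) ∈ F := hF₀ ⟨p.length, le_rfl, by simp⟩
  choose g hg hg1 using IsPartialIsometry.fst_surjective hG hreg hF ⟨_, hs⟩
  have hdist : ∀ x y, G.dist (g x).2 (g y).2 = G.dist x y := fun x y => by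
    rw [← hF.1.dist_eq _ (hg x) _ (hg y), hg1, hg1]
  have hadj : ∀ x y, G.Adj (g x).2 (g y).2 ↔ G.Adj x y := fun x y => by
    rw [← dist_eq_one_iff_adj, hdist, dist_eq_one_iff_adj]
  have hinj : Function.Injective fun x => (g x).2 := fun x y hxy => by
    rw [← hG.connected.dist_eq_zero_iff, ← hdist, hG.connected.dist_eq_zero_iff]
    exact hxy
  have hsurj : Function.Surjective fun x => (g x).2 := by
    refine forall_of_adj_closed hG.connected ⟨s, rfl⟩ ?_
    rintro _ y hy ⟨x, rfl⟩
    -- Neighbours go injectively to neighbours and all degrees are equal, so the image is closed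
    -- under adjacency.
    have himg : (G.neighborFinset x).image (fun x => (g x).2) = G.neighborFinset (g x).2 := by
      refine Finset.eq_of_subset_of_card_le ?_ ?_
      · intro z hz
        obtain ⟨w, hw, rfl⟩ := Finset.mem_image.1 hz
        rw [mem_neighborFinset] at hw ⊢
        exact (hadj x w).2 hw
      · rw [Finset.card_image_of_injective _ hinj, card_neighborFinset_eq_degree,
          card_neighborFinset_eq_degree, hreg, hreg]
    have : y ∈ (G.neighborFinset x).image (fun x => (g x).2) := by
      rw [himg, mem_neighborFinset]
      exact hy
    obtain ⟨w, -, hw⟩ := Finset.mem_image.1 this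
    exact ⟨w, hw⟩
  refine ⟨⟨Equiv.ofBijective _ ⟨hinj, hsurj⟩, fun {x y} => hadj x y⟩, ?_, ?_⟩
  · exact (hF.1.eq_iff hG (hg s) hs).1 (hg1 s)
  · exact (hF.1.eq_iff hG (hg v) hv).1 (hg1 v)

end Swap

/-! ### Events that depend on finitely many bits -/

section Bits

variable {V : Type u}

/-- The truth of `P` is determined by the bits in `T`. -/
def DependsOnBits (T : Finset (V × ℕ)) (P : (V → Seed) → Prop) : Prop :=
  ∀ ω ω' : V → Seed, (∀ p ∈ T, ω p.1 p.2 = ω' p.1 p.2) → (P ω ↔ P ω')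

/-- The bits in `T`. -/
def readBits (T : Finset (V × ℕ)) (ω : V → Seed) (p : T) : Bool := ω p.1.1 p.1.2

lemma measurable_readBits (T : Finset (V × ℕ)) : Measurable (readBits T) := by
  unfold readBits
  fun_prop

lemma DependsOnBits.eq_preimage {T : Finset (V × ℕ)} {P : (V → Seed) → Prop}
    (h : DependsOnBits T P) : {ω | P ω} = readBits T ⁻¹' (readBits T '' {ω | P ω}) := by
  refine (Set.subset_preimage_image _ _).antisymm ?_
  rintro ω ⟨ω', hω', heq⟩
  exact (h ω' ω fun p hp => congrFun heq ⟨p, hp⟩).1 hω'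

/-- Locality thus yields measurability: events about arcs, targets and levels need no measurability
argument of their own. -/
lemma DependsOnBits.measurableSet {T : Finset (V × ℕ)} {P : (V → Seed) → Prop}
    (h : DependsOnBits T P) : MeasurableSet {ω | P ω} := by
  rw [h.eq_preimage]
  exact measurable_readBits T (Set.toFinite _).measurableSet

end Bits

/-! ### Labels -/

section Labels

/-- The first `n` bits of a string, as a number. -/
def key (n : ℕ) (x : Seed) : ℕ := Encodable.encode fun k : Fin n => x k

/-- The part of a string that is reserved for level `i`. -/
def levelSeed (i : ℕ) (x : Seed) : Seed := fun k => x (Nat.pair i k)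

/-- The first `m` bits vanish. -/
def IsLow (m : ℕ) (x : Seed) : Prop := ∀ k < m, x k = false

/-- The length scale of level `i`. -/
def scale (B i : ℕ) : ℕ := B ^ 3 ^ i

/-- The maximal length of an arc in the refinement of level `i`. -/
def arcLength (B i : ℕ) : ℕ := 64 * scale B i ^ 2

/-- The number of bits that decide whether a vertex is low. -/
def lowBits (B i : ℕ) : ℕ := 4 * scale B i

/-- The number of bits that distinguish the low vertices. -/
def keyBits (B i : ℕ) : ℕ := scale B i ^ 3

open Classical in
/-- The label for level `i`. -/
def levelLabel (B i : ℕ) (x : Seed) : WithTop ℕ :=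
  if IsLow (lowBits B i) (levelSeed i x) then (key (keyBits B i) (levelSeed i x) : ℕ) else ⊤

/-- The bits that the label for level `i` uses. -/
def ownBits (B i : ℕ) : Finset ℕ :=
  (Finset.range (lowBits B i + keyBits B i)).image (Nat.pair i)

/-- The bits that the labels for the levels below `i` use. -/
def bitsBelow (B i : ℕ) : Finset ℕ := (Finset.range i).biUnion (ownBits B)

lemma key_eq_iff {n : ℕ} {x y : Seed} : key n x = key n y ↔ ∀ k < n, x k = y k := by
  rw [key, key, Encodable.encode_inj, funext_iff, Fin.forall_iff]

lemma levelSeed_eq_of_ownBits {B i : ℕ} {x y : Seed} (h : ∀ k ∈ ownBits B i, x k = y k) {k : ℕ}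
    (hk : k < lowBits B i + keyBits B i) : levelSeed i x k = levelSeed i y k :=
  h _ (Finset.mem_image_of_mem _ (Finset.mem_range.2 hk))

lemma isLow_congr {B i : ℕ} {x y : Seed} (h : ∀ k ∈ ownBits B i, x k = y k) :
    IsLow (lowBits B i) (levelSeed i x) ↔ IsLow (lowBits B i) (levelSeed i y) :=
  forall₂_congr fun k hk => by rw [levelSeed_eq_of_ownBits h (by omega)]

lemma levelLabel_congr {B i : ℕ} {x y : Seed} (h : ∀ k ∈ ownBits B i, x k = y k) :
    levelLabel B i x = levelLabel B i y := by
  have hkey : key (keyBits B i) (levelSeed i x) = key (keyBits B i) (levelSeed i y) :=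
    key_eq_iff.2 fun k hk => levelSeed_eq_of_ownBits h (by omega)
  unfold levelLabel
  rw [hkey]
  by_cases hx : IsLow (lowBits B i) (levelSeed i x)
  · rw [if_pos hx, if_pos ((isLow_congr h).1 hx)]
  · rw [if_neg hx, if_neg (mt (isLow_congr h).2 hx)]

lemma levelLabel_congr_of_bitsBelow {B i : ℕ} {x y : Seed} (h : ∀ k ∈ bitsBelow B i, x k = y k) :
    ∀ j < i, levelLabel B j x = levelLabel B j y := fun j hj =>
  levelLabel_congr fun k hk => h k (Finset.mem_biUnion.2 ⟨j, Finset.mem_range.2 hj, hk⟩)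

variable {B : ℕ}

lemma one_le_scale (hB : 1 ≤ B) (i : ℕ) : 1 ≤ scale B i := Nat.one_le_pow _ _ hB

lemma scale_succ (i : ℕ) : scale B (i + 1) = scale B i ^ 3 := by
  rw [scale, scale, pow_succ, pow_mul]

lemma le_scale (i : ℕ) : B ≤ scale B i :=
  Nat.le_self_pow (by positivity) B

lemma scale_mono : Monotone (scale B) :=
  monotone_nat_of_le_succ fun i => by
    rw [scale_succ]
    exact Nat.le_self_pow (by norm_num) _

lemma arcLength_mono : Monotone (arcLength B) := fun _ _ h => by
  unfold arcLength
  gcongr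
  exact scale_mono h

lemma one_le_arcLength (hB : 1 ≤ B) (i : ℕ) : 1 ≤ arcLength B i := by
  have := Nat.one_le_pow 2 _ (one_le_scale hB i)
  unfold arcLength
  omega

end Labels

/-! ### The hierarchy of levels -/

section Levels

open SimpleGraph

variable {V W : Type u} {G : SimpleGraph V} {H : SimpleGraph W} {B : ℕ}

/-- The decreasing hierarchy of vertex sets. -/
def level (B : ℕ) (G : SimpleGraph V) (x : V → Seed) : ℕ → Set V
  | 0 => Set.univ
  | i + 1 => refine G (level B G x i) (fun v => levelLabel B i (x v)) (arcLength B i)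

/-- Membership in level `i` is determined by a neighbourhood of this radius. -/
def levelRadius (B : ℕ) : ℕ → ℕ
  | 0 => 0
  | i + 1 => levelRadius B i + (3 * arcLength B i + 1)

lemma levelRadius_mono : Monotone (levelRadius B) :=
  monotone_nat_of_le_succ fun i => by rw [levelRadius]; omega

lemma level_antitone (x : V → Seed) : Antitone (level B G x) :=
  antitone_nat_of_succ_le fun _ => refine_subset

/-- The region of agreement shrinks by `3 * arcLength B i + 1` at each level. Only labels are
compared, so that a change of bits which no label reads is covered too. -/
lemma matches_level (φ : H ↪g G) {x : W → Seed} {y : V → Seed} {D : Set V}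
    (hD : D ⊆ Set.range φ) (i : ℕ)
    (hl : ∀ w, φ w ∈ D → ∀ j < i, levelLabel B j (x w) = levelLabel B j (y (φ w))) :
    Matches φ {a | ball G a (levelRadius B i) ⊆ D} (level B H x i) (level B G y i) := by
  have hsub : ∀ r, {a | ball G a r ⊆ D} ⊆ D := fun r a ha => ha (self_mem_ball a r)
  induction i with
  | zero => exact ⟨(hsub _).trans hD, fun w _ => Iff.rfl⟩
  | succ i ih =>
    have hM := ih fun w hw j hj => hl w hw j (by omega)
    refine ⟨(hsub _).trans hD, fun w hw => ?_⟩
    refine hM.mem_refine_iff (fun a ha => hl a (hsub _ ha) i (by omega)) fun b hb => ?_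
    refine (ball_subset_ball hb ?_).trans hw
    rw [levelRadius]
    omega

lemma mem_level_iff_of_bits {x y : V → Seed} (i : ℕ) {v : V}
    (h : ∀ w ∈ ball G v (levelRadius B i), ∀ k ∈ bitsBelow B i, x w k = y w k) :
    v ∈ level B G x i ↔ v ∈ level B G y i :=
  (matches_level (RelEmbedding.refl G.Adj) (D := ball G v (levelRadius B i))
    (fun w _ => ⟨w, rfl⟩) i fun w hw => levelLabel_congr_of_bitsBelow (h w hw)).mem_iff v
      (show ball G v _ ⊆ _ from subset_rfl)

/-- The position in the hierarchy after `m` steps: the level, and the thickness of the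
neighbourhood of the next level. -/
def stage (B : ℕ) : ℕ → ℕ × ℕ
  | 0 => (0, arcLength B 0)
  | m + 1 => if (stage B m).2 ≤ 1 then ((stage B m).1 + 1, arcLength B ((stage B m).1 + 1))
      else ((stage B m).1, (stage B m).2 - 1)

/-- A slow decreasing sequence of vertex sets that interpolates between the levels. -/
def flow (B : ℕ) (G : SimpleGraph V) (x : V → Seed) (m : ℕ) : Set V :=
  thicken G (level B G x (stage B m).1) (level B G x ((stage B m).1 + 1)) (stage B m).2

/-- Membership in the `m`-th set of the flow is determined by a neighbourhood of this radius. -/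
def flowRadius (B m : ℕ) : ℕ := levelRadius B ((stage B m).1 + 1) + arcLength B (stage B m).1

lemma stage_snd (hB : 1 ≤ B) (m : ℕ) :
    1 ≤ (stage B m).2 ∧ (stage B m).2 ≤ arcLength B (stage B m).1 := by
  induction m with
  | zero => exact ⟨one_le_arcLength hB 0, le_rfl⟩
  | succ m ih =>
    rw [stage]
    split_ifs with h
    · exact ⟨one_le_arcLength hB _, le_rfl⟩
    · exact ⟨by simp only; omega, by simp only; omega⟩

lemma stage_fst_mono : Monotone fun m => (stage B m).1 :=
  monotone_nat_of_le_succ fun m => by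
    simp only [stage]
    split_ifs <;> simp

lemma flowRadius_mono : Monotone (flowRadius B) := fun _ _ h =>
  add_le_add (levelRadius_mono (Nat.succ_le_succ (stage_fst_mono h)))
    (arcLength_mono (stage_fst_mono h))

lemma stage_add (i m k : ℕ) (hm : stage B m = (i, arcLength B i)) (hk : k < arcLength B i) :
    stage B (m + k) = (i, arcLength B i - k) := by
  induction k with
  | zero => simpa using hm
  | succ k ih =>
    rw [← add_assoc, stage, ih (by omega)]
    simp only
    rw [if_neg (by omega), Nat.sub_sub]

lemma stage_sum (hB : 1 ≤ B) (i : ℕ) :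
    stage B (∑ j ∈ Finset.range i, arcLength B j) = (i, arcLength B i) := by
  induction i with
  | zero => rfl
  | succ i ih =>
    have h := one_le_arcLength hB i
    have h2 := stage_add i _ (arcLength B i - 1) ih (by omega)
    rw [Finset.sum_range_succ, show ∑ j ∈ Finset.range i, arcLength B j + arcLength B i =
      ∑ j ∈ Finset.range i, arcLength B j + (arcLength B i - 1) + 1 by omega, stage, h2]
    simp only
    rw [if_pos (by omega)]

/-- At a change of level the new set is a thickening inside level i + 1, which was contained in the
previous set. -/
lemma flow_antitone (x : V → Seed) : Antitone (flow B G x) :=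
  antitone_nat_of_succ_le fun m => by
    unfold flow
    rw [stage]
    split_ifs with h
    · exact (thicken_subset (level_antitone x (Nat.le_succ _)) _).trans
        (thicken_mono (Nat.zero_le _))
    · exact thicken_mono (Nat.sub_le _ _)

lemma flow_subset_level (x : V → Seed) (m : ℕ) : flow B G x m ⊆ level B G x (stage B m).1 :=
  thicken_subset (level_antitone x (Nat.le_succ _)) _

lemma mem_flow_iff (φ : H ↪g G) {x : W → Seed} {y : V → Seed} {D : Set V}
    (hD : D ⊆ Set.range φ) (hxy : ∀ w, φ w ∈ D → x w = y (φ w)) (hB : 1 ≤ B) {m : ℕ} {w : W}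
    (hw : ball G (φ w) (flowRadius B m) ⊆ D) : w ∈ flow B H x m ↔ φ w ∈ flow B G y m := by
  have hl : ∀ i a, φ a ∈ D → ∀ j < i, levelLabel B j (x a) = levelLabel B j (y (φ a)) :=
    fun _ a ha _ _ => by rw [hxy a ha]
  have h1 := matches_level φ hD (stage B m).1 (hl _)
  have h2 := matches_level φ hD ((stage B m).1 + 1) (hl _)
  have hsub : {a | ball G a (levelRadius B ((stage B m).1 + 1)) ⊆ D} ⊆
      {a | ball G a (levelRadius B (stage B m).1) ⊆ D} := fun a ha =>
    (ball_mono (levelRadius_mono (Nat.le_succ _))).trans ha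
  refine Matches.mem_thicken_iff ⟨h2.1, fun a ha => h1.2 a (hsub ha)⟩ h2 _ fun b hb => ?_
  refine (ball_subset_ball hb ?_).trans hw
  have := (stage_snd hB m).2
  rw [flowRadius]
  omega

lemma measurableSet_mem_level [Finite W] (i : ℕ) (w : W) :
    MeasurableSet {x : W → Seed | w ∈ level B H x i} := by
  cases nonempty_fintype W
  refine DependsOnBits.measurableSet (T := Finset.univ ×ˢ bitsBelow B i) fun x y h => ?_
  exact mem_level_iff_of_bits i fun w _ k hk => h (w, k) (by simp [hk])

lemma measurableSet_mem_flow [Finite W] (m : ℕ) (w : W) :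
    MeasurableSet {x : W → Seed | w ∈ flow B H x m} := by
  have key : ∀ i j k (w : W),
      MeasurableSet {x : W → Seed | w ∈ thicken H (level B H x i) (level B H x j) k} := by
    intro i j k
    induction k with
    | zero => exact fun w => measurableSet_mem_level j w
    | succ k ih =>
      intro w
      refine (ih w).union ((measurableSet_mem_level i w).inter ?_)
      have : {x : W → Seed | ∃ u ∈ thicken H (level B H x i) (level B H x j) k, H.Adj w u} =
          ⋃ u ∈ {u | H.Adj w u},
            {x : W → Seed | u ∈ thicken H (level B H x i) (level B H x j) k} := by
        ext x
        simp [and_comm]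
      have hm := MeasurableSet.biUnion (Set.to_countable {u | H.Adj w u}) fun u _ => ih u
      rwa [← this] at hm
  exact key _ _ _ w

end Levels

/-! ### The algorithm -/

section Algorithm

open SimpleGraph

variable {V W : Type u} {G : SimpleGraph V} {H : SimpleGraph W} {B : ℕ}

/-- The vertex `r` leaves the flow after step `m`, and `u` is its neighbour with the strictly
least key among those that do not leave. -/
def IsParentAt (B : ℕ) (H : SimpleGraph W) (r : W) (n : ℕ) (x : W → Seed) (m : ℕ) (u : W) : Prop :=
  flowRadius B (m + 1) + 1 ≤ n ∧ r ∈ flow B H x m ∧ r ∉ flow B H x (m + 1) ∧ H.Adj r u ∧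
    u ∈ flow B H x (m + 1) ∧
      ∀ u', H.Adj r u' → u' ∈ flow B H x (m + 1) → u' ≠ u → key n (x u) < key n (x u')

/-- The parent that is visible at radius `n`. -/
def IsParent (B : ℕ) (H : SimpleGraph W) (r : W) (n : ℕ) (x : W → Seed) (u : W) : Prop :=
  ∃ m, IsParentAt B H r n x m u

lemma exit_unique {x : W → Seed} {r : W} {m m' : ℕ} (h : r ∈ flow B H x m)
    (h' : r ∉ flow B H x (m + 1)) (k : r ∈ flow B H x m') (k' : r ∉ flow B H x (m' + 1)) :
    m = m' := by
  rcases lt_trichotomy m m' with hlt | rfl | hlt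
  · exact absurd (flow_antitone x hlt k) h'
  · rfl
  · exact absurd (flow_antitone x hlt h) k'

lemma IsParent.unique {r : W} {n : ℕ} {x : W → Seed} {u u' : W} (h : IsParent B H r n x u)
    (h' : IsParent B H r n x u') : u = u' := by
  obtain ⟨m, -, h1, h2, h3, h4, h5⟩ := h
  obtain ⟨m', -, h1', h2', h3', h4', h5'⟩ := h'
  obtain rfl := exit_unique h1 h2 h1' h2'
  by_contra hne
  exact lt_asymm (h5 u' h3' h4' (Ne.symm hne)) (h5' u h3 h4 hne)

/-- The radius condition in `IsParentAt` makes every membership that is queried at `r` and its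
neighbours visible in the ball of radius `n`. The same `n` is the number of key bits compared. -/
lemma isParent_embedding (hB : 1 ≤ B) (φ : H ↪g G) {x : W → Seed} {y : V → Seed} {r : W} {n : ℕ}
    (hD : ball G (φ r) n ⊆ Set.range φ) (hxy : ∀ w, φ w ∈ ball G (φ r) n → x w = y (φ w))
    {u : W} : IsParent B H r n x u ↔ IsParent B G (φ r) n y (φ u) := by
  refine exists_congr fun m => and_congr_right fun hm => ?_
  have hmono := flowRadius_mono (B := B) (Nat.le_add_right m 1)
  have hadj : ∀ {a}, H.Adj r a → (a ∈ flow B H x (m + 1) ↔ φ a ∈ flow B G y (m + 1)) ∧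
      x a = y (φ a) := fun ha => by
    have ha' := mem_ball_of_adj (φ.map_adj_iff.2 ha)
    exact ⟨mem_flow_iff φ hD hxy hB (ball_subset_ball ha' (by omega)),
      hxy _ (ball_mono (by omega) ha')⟩
  rw [mem_flow_iff φ hD hxy hB (ball_mono (by omega) : ball G (φ r) (flowRadius B m) ⊆ _),
    mem_flow_iff φ hD hxy hB (ball_mono (by omega) : ball G (φ r) (flowRadius B (m + 1)) ⊆ _),
    φ.map_adj_iff]
  refine and_congr_right fun _ => and_congr_right fun _ => and_congr_right fun hu => ?_
  refine and_congr (hadj hu).1 ⟨fun h u' hu' hf hne => ?_, fun h u' hu' hf hne => ?_⟩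
  · obtain ⟨u', rfl⟩ := hD (ball_mono (by omega) (mem_ball_of_adj hu'))
    rw [φ.map_adj_iff] at hu'
    rw [← (hadj hu).2, ← (hadj hu').2]
    exact h u' hu' ((hadj hu').1.2 hf) fun h => hne (h ▸ rfl)
  · rw [(hadj hu).2, (hadj hu').2]
    exact h _ (φ.map_adj_iff.2 hu') ((hadj hu').1.1 hf) (φ.injective.ne hne)

lemma measurable_key (n : ℕ) : Measurable (key n) := by
  have h : Measurable fun (x : Seed) (k : Fin n) => x k := by fun_prop
  exact (Measurable.of_discrete (f := fun a : Fin n → Bool => Encodable.encode a)).comp h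

lemma measurableSet_isParent [Finite W] (r : W) (n : ℕ) (u : W) :
    MeasurableSet {x : W → Seed | IsParent B H r n x u} := by
  have : {x : W → Seed | IsParent B H r n x u} = ⋃ m ∈ {m | flowRadius B (m + 1) + 1 ≤ n},
      ({x | r ∈ flow B H x m} ∩ ({x | r ∈ flow B H x (m + 1)}ᶜ ∩ ({_x | H.Adj r u} ∩
        ({x | u ∈ flow B H x (m + 1)} ∩ ⋂ u' ∈ {u' | H.Adj r u' ∧ u' ≠ u},
          ({x | u' ∈ flow B H x (m + 1)}ᶜ ∪ {x | key n (x u) < key n (x u')}))))) := by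
    ext x
    simp only [IsParent, IsParentAt, Set.mem_ofPred_eq, Set.mem_iUnion, Set.mem_inter_iff,
      Set.mem_compl_iff, Set.mem_iInter, Set.mem_union, exists_prop]
    refine exists_congr fun m => and_congr_right fun _ => and_congr_right fun _ =>
      and_congr_right fun _ => and_congr_right fun _ => and_congr_right fun _ =>
      forall_congr' fun u' => ?_
    tauto
  rw [this]
  refine MeasurableSet.biUnion (Set.to_countable _) fun m _ => ?_
  refine (measurableSet_mem_flow m r).inter ((measurableSet_mem_flow _ r).compl.inter
    ((MeasurableSet.const _).inter ((measurableSet_mem_flow _ u).inter ?_)))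
  refine MeasurableSet.biInter (Set.to_countable _) fun u' _ => ?_
  refine (measurableSet_mem_flow _ u').compl.union (measurableSet_lt ?_ ?_)
  · exact (measurable_key n).comp (measurable_pi_apply u)
  · exact (measurable_key n).comp (measurable_pi_apply u')

open Classical in
/-- The visible parent, if there is one. -/
def parentOut (B : ℕ) (H : SimpleGraph W) (r : W) (n : ℕ) (x : W → Seed) : Option W :=
  if h : ∃ u, IsParent B H r n x u then some h.choose else none

lemma parentOut_eq_some {r : W} {n : ℕ} {x : W → Seed} {u : W} :
    parentOut B H r n x = some u ↔ IsParent B H r n x u := by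
  unfold parentOut
  constructor
  · intro h
    split_ifs at h with hex
    obtain rfl := Option.some.inj h
    exact hex.choose_spec
  · intro h
    have hex : ∃ u, IsParent B H r n x u := ⟨u, h⟩
    rw [dif_pos hex, hex.choose_spec.unique h]

/-- The algorithm: every vertex grabs the edge to its parent in the flow. -/
def flowAlgorithm (B : ℕ) (hB : 1 ≤ B) : UniformAlgorithm.{u} where
  out _ H r n x := parentOut B H r n x
  out_adj W H r n x w h := by
    obtain ⟨m, -, -, -, h, -⟩ := parentOut_eq_some.1 h
    exact h
  out_iso W W' H H' φ r n x := by
    refine Option.ext fun u => ?_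
    rw [parentOut_eq_some, Option.map_eq_some_iff]
    obtain ⟨u, rfl⟩ := φ.surjective u
    have hiff : IsParent B H r n (fun w => x (φ w)) u ↔ IsParent B H' (φ r) n x (φ u) :=
      isParent_embedding hB φ.toEmbedding (fun w _ => φ.surjective w) fun _ _ => rfl
    rw [← hiff]
    constructor
    · exact fun h => ⟨u, parentOut_eq_some.2 h, rfl⟩
    · rintro ⟨u', h, h'⟩
      rw [← φ.injective h']
      exact parentOut_eq_some.1 h
  out_measurable W _ H r n o := by
    have hsome : ∀ u, {x : W → Seed | parentOut B H r n x = some u} =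
        {x | IsParent B H r n x u} := fun u => Set.ext fun x => parentOut_eq_some
    cases o with
    | some u =>
      rw [hsome]
      exact measurableSet_isParent r n u
    | none =>
      have : {x : W → Seed | parentOut B H r n x = none} =
          (⋃ u, {x | parentOut B H r n x = some u})ᶜ := by
        ext x
        simp [Option.eq_none_iff_forall_ne_some]
      rw [this]
      refine (MeasurableSet.iUnion fun u => ?_).compl
      rw [hsome]
      exact measurableSet_isParent r n u

end Algorithm

/-! ### The flow on a regular tree -/

section Tree

open SimpleGraph

variable {V : Type u} {G : SimpleGraph V} {B Δ : ℕ}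

/-- Refinement replaces 8b by 64b² + 1, and this is at most 8b³, eight times the next scale, once b
≥ 9. -/
lemma isBranchy_level (hB : 9 ≤ B) (hΔ : 3 ≤ Δ) [G.LocallyFinite]
    (hreg : G.IsRegularOfDegree Δ) (x : V → Seed) (i : ℕ) :
    IsBranchy G (level B G x i) (8 * scale B i) := by
  have hs := one_le_scale (by omega : 1 ≤ B)
  induction i with
  | zero => exact isBranchy_univ hΔ hreg (by have := hs 0; omega)
  | succ i ih =>
    have h9 := hB.trans (le_scale (B := B) i)
    refine IsBranchy.mono ?_ (IsBranchy.refine (ih.mono ?_))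
    · rw [arcLength, scale_succ]
      nlinarith [Nat.mul_le_mul_right (scale B i ^ 2) h9, Nat.one_le_pow 2 _ (hs i)]
    · rw [arcLength]
      nlinarith [hs i]

lemma isBranchy_level_arcLength (hB : 9 ≤ B) (hΔ : 3 ≤ Δ) [G.LocallyFinite]
    (hreg : G.IsRegularOfDegree Δ) (x : V → Seed) (i : ℕ) :
    IsBranchy G (level B G x i) (arcLength B i) := by
  refine (isBranchy_level hB hΔ hreg x i).mono ?_
  have := one_le_scale (by omega : 1 ≤ B) i
  rw [arcLength]
  nlinarith

lemma flow_zero (hB : 9 ≤ B) (hΔ : 3 ≤ Δ) [G.LocallyFinite] (hreg : G.IsRegularOfDegree Δ)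
    (x : V → Seed) : flow B G x 0 = Set.univ :=
  (isBranchy_level_arcLength hB hΔ hreg x 0).thicken_refine

/-- Each step of the flow removes the outermost layer of a thickening, whose vertices hang on the
previous layer. At a change of level this is still true, because the full thickening of the next
level but one is the next level itself. -/
lemma exists_adj_of_mem_flow (hB : 9 ≤ B) (hΔ : 3 ≤ Δ) [G.LocallyFinite]
    (hreg : G.IsRegularOfDegree Δ) (x : V → Seed) {m : ℕ} {v : V} (hv : v ∈ flow B G x m)
    (hv' : v ∉ flow B G x (m + 1)) : ∃ u ∈ flow B G x (m + 1), G.Adj v u := by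
  obtain ⟨h1, -⟩ := stage_snd (by omega : 1 ≤ B) m
  obtain ⟨k, hk⟩ : ∃ k, (stage B m).2 = k + 1 := ⟨_, (Nat.sub_add_cancel h1).symm⟩
  have hflow : flow B G x (m + 1) =
      thicken G (level B G x (stage B m).1) (level B G x ((stage B m).1 + 1)) k := by
    unfold flow
    rw [stage]
    split_ifs with h
    · obtain rfl : k = 0 := by omega
      exact (isBranchy_level_arcLength hB hΔ hreg x _).thicken_refine
    · simp only [hk, Nat.add_sub_cancel]
  rw [hflow] at hv' ⊢
  unfold flow at hv
  rw [hk] at hv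
  exact (hv.resolve_left hv').2

lemma exists_exit (hB : 9 ≤ B) (hΔ : 3 ≤ Δ) [G.LocallyFinite] (hreg : G.IsRegularOfDegree Δ)
    (x : V → Seed) {m : ℕ} {v : V} (hv : v ∉ flow B G x m) :
    ∃ k < m, v ∈ flow B G x k ∧ v ∉ flow B G x (k + 1) := by
  induction m with
  | zero => exact absurd (flow_zero hB hΔ hreg x ▸ Set.mem_univ v) hv
  | succ m ih =>
    by_cases h : v ∈ flow B G x m
    · exact ⟨m, by omega, h, hv⟩
    · obtain ⟨k, hk, h⟩ := ih h
      exact ⟨k, by omega, h⟩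

lemma answer_eq_some {hB : 1 ≤ B} {ω : V → Seed} {v : V} {n : ℕ} {u : ball G v n} :
    (flowAlgorithm B hB).answer G ω v n = some u ↔ IsParent B G v n ω u := by
  refine parentOut_eq_some.trans ?_
  exact isParent_embedding hB (Embedding.induce (G := G) (ball G v n)) (r := ballCenter G v n)
    (y := ω) (fun w hw => ⟨⟨w, hw⟩, rfl⟩) fun _ _ => rfl

lemma answer_ne_none_of_isParent {hB : 1 ≤ B} {ω : V → Seed} {v : V} {n : ℕ} {u : V}
    (h : IsParent B G v n ω u) : (flowAlgorithm B hB).answer G ω v n ≠ none := by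
  have hu : u ∈ ball G v n := by
    obtain ⟨m, hn, -, -, hadj, -⟩ := h
    exact ball_mono (by omega) (mem_ball_of_adj hadj)
  rw [(answer_eq_some (u := ⟨u, hu⟩)).2 h]
  exact Option.some_ne_none _

lemma exists_isParent_of_run {hB : 1 ≤ B} {ω : V → Seed} {v u : V}
    (h : (flowAlgorithm B hB).run G ω v = some u) : ∃ n, IsParent B G v n ω u := by
  unfold UniformAlgorithm.run at h
  split_ifs at h with hex
  rw [Option.map_eq_some_iff] at h
  obtain ⟨u, hu, rfl⟩ := h
  exact ⟨_, answer_eq_some.1 hu⟩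

lemma run_ne_none {A : UniformAlgorithm.{u}} {ω : V → Seed} {v : V} {n : ℕ}
    (h : A.answer G ω v n ≠ none) : ∃ u, A.run G ω v = some u := by
  classical
  have hex : ∃ n, A.answer G ω v n ≠ none := ⟨n, h⟩
  unfold UniformAlgorithm.run
  rw [dif_pos hex]
  obtain ⟨u, hu⟩ := Option.ne_none_iff_exists'.1 (Nat.find_spec hex)
  exact ⟨u, by rw [hu]; rfl⟩

lemma answer_congr {A : UniformAlgorithm.{u}} {ω ω' : V → Seed} {v : V} {n : ℕ}
    (h : ∀ w ∈ ball G v n, ω' w = ω w) : A.answer G ω' v n = A.answer G ω v n := by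
  unfold UniformAlgorithm.answer
  congr 1
  ext w : 1
  exact h w w.2

lemma run_congr {A : UniformAlgorithm.{u}} {ω ω' : V → Seed} {v : V} {n : ℕ}
    (h : ∀ w ∈ ball G v n, ω' w = ω w) (hn : A.answer G ω v n ≠ none) :
    A.run G ω' v = A.run G ω v := by
  classical
  have hc : ∀ k ≤ n, A.answer G ω' v k = A.answer G ω v k := fun k hk =>
    answer_congr fun w hw => h w (ball_mono hk hw)
  have hex : ∃ n, A.answer G ω v n ≠ none := ⟨n, hn⟩
  have hex' : ∃ n, A.answer G ω' v n ≠ none := ⟨n, by rwa [hc n le_rfl]⟩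
  have hle := Nat.find_min' hex hn
  have hfind : Nat.find hex' = Nat.find hex := by
    refine (Nat.find_eq_iff hex').2 ⟨?_, fun k hk => ?_⟩
    · rw [hc _ hle]
      exact Nat.find_spec hex
    · rw [hc _ (by omega)]
      exact Nat.find_min hex hk
  unfold UniformAlgorithm.run
  rw [dif_pos hex, dif_pos hex']
  have h1 : ∀ a b, a = b → (A.answer G ω' v a).map Subtype.val =
      (A.answer G ω' v b).map Subtype.val := by
    rintro a _ rfl
    rfl
  convert (h1 _ _ hfind).trans (congrArg _ (hc _ hle))

lemma codingRadius_le {A : UniformAlgorithm.{u}} {ω : V → Seed} {v : V} {n : ℕ}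
    (h : A.answer G ω v n ≠ none) : A.codingRadius G ω v ≤ n :=
  iInf₂_le n h

lemma exists_answer_of_codingRadius_ne_top {A : UniformAlgorithm.{u}} {ω : V → Seed} {v : V}
    (h : A.codingRadius G ω v ≠ ⊤) : ∃ n, A.answer G ω v n ≠ none := by
  by_contra! hcon
  refine h ?_
  unfold UniformAlgorithm.codingRadius
  simp [hcon]

/-- A visible parent exists as soon as the keys of the neighbours are distinct. -/
lemma exists_isParent (hB : 9 ≤ B) (hΔ : 3 ≤ Δ) [G.LocallyFinite]
    (hreg : G.IsRegularOfDegree Δ) {ω : V → Seed} {m n : ℕ} {v : V} (hv : v ∉ flow B G ω m)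
    (hn : flowRadius B m + 1 ≤ n)
    (hkey : ∀ a ∈ ball G v 1, ∀ b ∈ ball G v 1, key n (ω a) = key n (ω b) → a = b) :
    ∃ u, IsParent B G v n ω u := by
  obtain ⟨k, hk, hk1, hk2⟩ := exists_exit hB hΔ hreg ω hv
  obtain ⟨u₀, hu₀, h₀⟩ := exists_adj_of_mem_flow hB hΔ hreg ω hk1 hk2
  have hne : {u | u ∈ flow B G ω (k + 1) ∧ G.Adj v u}.Nonempty := ⟨u₀, hu₀, h₀⟩
  have hwf := InvImage.wf (fun u => key n (ω u)) wellFounded_lt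
  obtain ⟨u, ⟨hu, hadj⟩, hmin⟩ := hwf.has_min _ hne
  refine ⟨u, k, ?_, hk1, hk2, hadj, hu, fun u' hu' hf hne' => ?_⟩
  · have := flowRadius_mono (B := B) (show k + 1 ≤ m from hk)
    omega
  · refine lt_of_le_of_ne (not_lt.1 (hmin u' ⟨hf, hu'⟩)) fun heq => hne' ?_
    exact (hkey _ (mem_ball_of_adj hadj) _ (mem_ball_of_adj hu') heq).symm

/-- A subtree lies in the ball whose radius bounds the exit time of its root, and its vertices
leave the flow not later than the root. -/
lemma subtree_subset {hB : 1 ≤ B} {ω : V → Seed} {m : ℕ} {v w : V} (hv : v ∉ flow B G ω m)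
    (hw : w ∈ subtree ((flowAlgorithm B hB).run G ω) v) :
    w ∈ ball G v m ∧ w ∉ flow B G ω m := by
  -- The bound `j` on the exit time drops by at least one for each edge away from the root, so the
  -- distance to `v` is at most `m - j`.
  have main : ∃ j ≤ m, w ∉ flow B G ω j ∧ v ∈ ball G w (m - j) := by
    refine Relation.ReflTransGen.head_induction_on hw ⟨m, le_rfl, hv, self_mem_ball _ _⟩ ?_
    rintro a c hac - ⟨j, hj, hc, hb⟩
    obtain ⟨n, k, -, h1, h2, h3, h4, -⟩ := exists_isParent_of_run hac
    have hkj : k + 1 < j := by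
      by_contra! hle
      exact hc (flow_antitone ω hle h4)
    exact ⟨k + 1, by omega, h2, ball_subset_ball (mem_ball_of_adj h3) (by omega) hb⟩
  obtain ⟨j, hj, h1, h2⟩ := main
  exact ⟨mem_ball_comm.1 (ball_mono (Nat.sub_le _ _) h2),
    fun h => h1 (flow_antitone ω hj h)⟩

lemma subtree_subset_of_eq {p p' : V → Option V} {v : V} (h : ∀ w ∈ subtree p v, p w = p' w) :
    subtree p v ⊆ subtree p' v := by
  intro w hw
  refine Relation.ReflTransGen.head_induction_on hw .refl fun {a c} hac hc ih => ?_
  refine .head ?_ ih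
  rw [← h a (.head hac hc)]
  exact hac

/-- For both `ω` and `ω'` the descendants of `v` lie in `ball G v m` and have left the flow by step
`m`. There the two runs agree, so neither subtree can contain a new vertex. -/
lemma determinesSubtree (hB : 9 ≤ B) (hB' : 1 ≤ B) (hΔ : 3 ≤ Δ) [G.LocallyFinite]
    (hreg : G.IsRegularOfDegree Δ) {ω : V → Seed} {m n : ℕ} {v : V} (hv : v ∉ flow B G ω m)
    (hn : flowRadius B m + 1 ≤ n)
    (hkey : ∀ a ∈ ball G v (m + 1), ∀ b ∈ ball G v (m + 1), key n (ω a) = key n (ω b) → a = b) :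
    DeterminesSubtree (flowAlgorithm B hB') G ω v (m + n) := by
  refine ⟨fun w hw => ball_mono (by omega) (subtree_subset hv hw).1, fun ω' hω' => ?_⟩
  have hflow : ∀ w ∈ ball G v m, w ∈ flow B G ω' m ↔ w ∈ flow B G ω m := by
    intro w hw
    refine mem_flow_iff (RelEmbedding.refl G.Adj) (D := ball G v (m + n)) (fun a _ => ⟨a, rfl⟩)
      hω' hB' (w := w) ?_
    exact ball_subset_ball hw (by omega)
  have hrun : ∀ w ∈ ball G v m, w ∉ flow B G ω m →
      (flowAlgorithm B hB').run G ω' w = (flowAlgorithm B hB').run G ω w := by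
    intro w hw hwm
    obtain ⟨u, hu⟩ := exists_isParent hB hΔ hreg hwm hn fun a ha b hb =>
      hkey a (mem_ball_trans hw ha) b (mem_ball_trans hw hb)
    exact run_congr (fun a ha => hω' a (mem_ball_trans hw ha)) (answer_ne_none_of_isParent hu)
  have hv' : v ∉ flow B G ω' m := fun h => hv ((hflow v (self_mem_ball _ _)).1 h)
  refine (subtree_subset_of_eq fun w hw => ?_).antisymm (subtree_subset_of_eq fun w hw => ?_)
  · obtain ⟨h1, h2⟩ := subtree_subset hv' hw
    exact hrun w h1 fun h => h2 ((hflow w h1).2 h)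
  · obtain ⟨h1, h2⟩ := subtree_subset hv hw
    exact (hrun w h1 h2).symm

lemma subtreeRadius_le {A : UniformAlgorithm.{u}} {ω : V → Seed} {v : V} {n : ℕ}
    (h : DeterminesSubtree A G ω v n) : subtreeRadius A G ω v ≤ n :=
  iInf₂_le n h

lemma finite_ball [G.LocallyFinite] (v : V) (n : ℕ) : (ball G v n).Finite := by
  induction n with
  | zero =>
    refine (Set.finite_singleton v).subset fun w hw => ?_
    obtain ⟨p, hp⟩ := mem_ball_iff.1 hw
    exact (Walk.eq_of_length_eq_zero (Nat.le_zero.1 hp)).symm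
  | succ n ih =>
    refine (ih.union (ih.biUnion fun w _ => (G.neighborFinset w).finite_toSet)).subset
      fun w hw => ?_
    obtain ⟨p, hp⟩ := mem_ball_iff.1 hw
    by_cases hn : p.Nil
    · exact Or.inl (by rw [← hn.eq]; exact self_mem_ball _ _)
    · refine Or.inr (Set.mem_biUnion (x := p.penultimate) (mem_ball_iff.2 ⟨p.dropLast, ?_⟩) ?_)
      · simp; omega
      · simpa using p.adj_penultimate hn

/-- Finite coding radii suffice: strictly increasing exit times exclude an edge grabbed from both
sides, and the exit time of `v` confines its subtree to a finite ball. -/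
lemma isOneEndedSpanningForest_run {hB : 1 ≤ B} [G.LocallyFinite] {ω : V → Seed}
    (hrun : ∀ v, (flowAlgorithm B hB).codingRadius G ω v ≠ ⊤) :
    IsOneEndedSpanningForest G ((flowAlgorithm B hB).run G ω) := by
  have hp : ∀ v, ∃ u, (flowAlgorithm B hB).run G ω v = some u := fun v => by
    obtain ⟨n, hn⟩ := exists_answer_of_codingRadius_ne_top (hrun v)
    exact run_ne_none hn
  refine ⟨⟨fun v => ?_, fun v u hu hv => ?_⟩, fun v => ?_⟩
  · obtain ⟨u, hu⟩ := hp v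
    obtain ⟨n, m, -, -, -, h, -⟩ := exists_isParent_of_run hu
    exact ⟨u, hu, h⟩
  · obtain ⟨n, m, -, h1, h2, -, h3, -⟩ := exists_isParent_of_run hu
    obtain ⟨n', m', -, h1', h2', -, h3', -⟩ := exists_isParent_of_run hv
    have hlt : m < m' := by
      by_contra! hle
      exact h2' (flow_antitone ω (by omega) h3)
    exact h2 (flow_antitone ω (by omega) h3')
  · obtain ⟨u, hu⟩ := hp v
    obtain ⟨n, m, -, -, h2, -⟩ := exists_isParent_of_run hu
    exact (finite_ball v (m + 1)).subset fun w hw => (subtree_subset h2 hw).1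

end Tree

/-! ### Independence of the bits -/

section Independence

open ProbabilityTheory
open scoped ENNReal

variable {V : Type u}

lemma iIndepFun_bits :
    iIndepFun (fun (p : V × ℕ) (ω : V → Seed) => ω p.1 p.2) (iidMeasure V) :=
  iIndepFun_uncurry_infinitePi' (X := fun (_ : V) (_ : ℕ) (b : Bool) => b)
    (fun _ _ => (PMF.uniformOfFintype Bool).toMeasure) fun _ _ => measurable_id

lemma DependsOnBits.measure_inter {T T' : Finset (V × ℕ)} (hT : Disjoint T T')
    {P Q : (V → Seed) → Prop} (hP : DependsOnBits T P) (hQ : DependsOnBits T' Q) :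
    iidMeasure V ({ω | P ω} ∩ {ω | Q ω}) = iidMeasure V {ω | P ω} * iidMeasure V {ω | Q ω} := by
  have h := (iIndepFun_bits (V := V)).indepFun_finset T T' hT fun p => by fun_prop
  rw [hP.eq_preimage, hQ.eq_preimage]
  exact h.measure_inter_preimage_eq_mul _ _ (Set.toFinite _).measurableSet
    (Set.toFinite _).measurableSet

lemma coin_singleton (b : Bool) : (PMF.uniformOfFintype Bool).toMeasure {b} = 2⁻¹ := by
  rw [PMF.toMeasure_apply_singleton _ _ (measurableSet_singleton b)]
  simp

lemma measure_bit_eq (v : V) (k : ℕ) (b : Bool) :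
    iidMeasure V {ω | ω v k = b} = 2⁻¹ := by
  have h1 : (iidMeasure V).map (fun ω => ω v) = seedMeasure := Measure.infinitePi_map_eval _ v
  have h2 : seedMeasure.map (fun x => x k) = (PMF.uniformOfFintype Bool).toMeasure :=
    Measure.infinitePi_map_eval _ k
  rw [← coin_singleton b, ← h2, ← h1, Measure.map_map (by fun_prop) (by fun_prop),
    Measure.map_apply (by fun_prop) (measurableSet_singleton b)]
  rfl

lemma dependsOnBits_bit (v : V) (k : ℕ) (b : Bool) :
    DependsOnBits {(v, k)} fun ω : V → Seed => ω v k = b := fun ω ω' h => by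
  have : ω v k = ω' v k := h (v, k) (Finset.mem_singleton_self _)
  beta_reduce
  rw [this]

/-- Two different strings agree in a given position with probability one half. -/
lemma measure_bit_eq_bit {v w : V} (hvw : v ≠ w) (k : ℕ) :
    iidMeasure V {ω | ω v k = ω w k} = 2⁻¹ := by
  have hb : ∀ b, iidMeasure V ({ω | ω v k = b} ∩ {ω | ω w k = b}) = 2⁻¹ * 2⁻¹ := fun b => by
    rw [(dependsOnBits_bit v k b).measure_inter (by simpa using hvw) (dependsOnBits_bit w k b),
      measure_bit_eq, measure_bit_eq]
  have hset : {ω : V → Seed | ω v k = ω w k} =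
      ({ω | ω v k = true} ∩ {ω | ω w k = true}) ∪ ({ω | ω v k = false} ∩ {ω | ω w k = false}) := by
    ext ω
    simp only [Set.mem_ofPred_eq, Set.mem_union, Set.mem_inter_iff]
    cases ω v k <;> cases ω w k <;> simp
  rw [hset, measure_union, hb, hb, ← two_mul, ← mul_assoc,
    ENNReal.mul_inv_cancel two_ne_zero ENNReal.ofNat_ne_top, one_mul]
  · refine Set.disjoint_left.2 fun ω h h' => ?_
    have h1 : ω v k = true := h.1
    have h2 : ω v k = false := h'.1
    simp [h1] at h2
  · exact (dependsOnBits_bit v k false).measurableSet.inter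
      (dependsOnBits_bit w k false).measurableSet

/-- Two different strings agree in `n` given positions with probability `2⁻ⁿ`. -/
lemma measure_bits_agree {v w : V} (hvw : v ≠ w) {f : ℕ → ℕ} (hf : f.Injective) (n : ℕ) :
    iidMeasure V {ω | ∀ k < n, ω v (f k) = ω w (f k)} = 2⁻¹ ^ n := by
  classical
  induction n with
  | zero => simp
  | succ n ih =>
    have hset : {ω : V → Seed | ∀ k < n + 1, ω v (f k) = ω w (f k)} =
        {ω | ∀ k < n, ω v (f k) = ω w (f k)} ∩ {ω | ω v (f n) = ω w (f n)} := by
      ext ω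
      simp only [Set.mem_ofPred_eq, Set.mem_inter_iff, Nat.lt_succ_iff_lt_or_eq, or_imp,
        forall_and, forall_eq]
    have h1 : DependsOnBits ({v, w} ×ˢ (Finset.range n).image f)
        fun ω : V → Seed => ∀ k < n, ω v (f k) = ω w (f k) := fun ω ω' h =>
      forall₂_congr fun k hk => by
        have hk' := Finset.mem_image_of_mem f (Finset.mem_range.2 hk)
        have hv : ω v (f k) = ω' v (f k) := h (v, f k) (Finset.mk_mem_product (by simp) hk')
        have hw : ω w (f k) = ω' w (f k) := h (w, f k) (Finset.mk_mem_product (by simp) hk')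
        rw [hv, hw]
    have h2 : DependsOnBits ({v, w} ×ˢ {f n}) fun ω : V → Seed => ω v (f n) = ω w (f n) :=
      fun ω ω' h => by
        have hv : ω v (f n) = ω' v (f n) := h (v, f n) (by simp)
        have hw : ω w (f n) = ω' w (f n) := h (w, f n) (by simp)
        beta_reduce
        rw [hv, hw]
    have hdisj : Disjoint (({v, w} : Finset V) ×ˢ (Finset.range n).image f)
        (({v, w} : Finset V) ×ˢ {f n}) := by
      refine Finset.disjoint_product.2 (Or.inr (Finset.disjoint_singleton_right.2 fun h => ?_))
      obtain ⟨k, hk, hkn⟩ := Finset.mem_image.1 h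
      exact (Finset.mem_range.1 hk).ne (hf hkn)
    rw [hset, h1.measure_inter hdisj h2, ih, measure_bit_eq_bit hvw, pow_succ]

lemma measure_key_eq {v w : V} (hvw : v ≠ w) (n : ℕ) :
    iidMeasure V {ω | key n (ω v) = key n (ω w)} = 2⁻¹ ^ n := by
  simp only [key_eq_iff]
  exact measure_bits_agree hvw Function.injective_id n

lemma measure_level_key_eq {v w : V} (hvw : v ≠ w) (i n : ℕ) :
    iidMeasure V {ω | key n (levelSeed i (ω v)) = key n (levelSeed i (ω w))} = 2⁻¹ ^ n := by
  simp only [key_eq_iff, levelSeed]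
  exact measure_bits_agree hvw (fun a b h => (Nat.pair_eq_pair.1 h).2) n

/-- Two of the strings in a finite set have the same key with small probability. -/
lemma measure_exists_tie_le (f : ℕ → Seed → ℕ) (n : ℕ)
    (hf : ∀ v w : V, v ≠ w → iidMeasure V {ω | f n (ω v) = f n (ω w)} = 2⁻¹ ^ n) (S : Finset V) :
    iidMeasure V {ω | ∃ a ∈ S, ∃ b ∈ S, f n (ω a) = f n (ω b) ∧ a ≠ b} ≤
      (S.card : ℝ≥0∞) ^ 2 * 2⁻¹ ^ n := by
  classical
  have hsub : {ω : V → Seed | ∃ a ∈ S, ∃ b ∈ S, f n (ω a) = f n (ω b) ∧ a ≠ b} ⊆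
      ⋃ p ∈ (S ×ˢ S).filter fun p => p.1 ≠ p.2, {ω | f n (ω p.1) = f n (ω p.2)} := by
    rintro ω ⟨a, ha, b, hb, h, hne⟩
    exact Set.mem_biUnion (x := (a, b)) (by simp [ha, hb, hne]) h
  refine (measure_mono hsub).trans ((measure_biUnion_finset_le _ _).trans ?_)
  refine (Finset.sum_le_card_nsmul _ _ _ fun p hp => (hf _ _ (Finset.mem_filter.1 hp).2).le).trans ?_
  rw [nsmul_eq_mul]
  gcongr
  have : ((S ×ˢ S).filter fun p => p.1 ≠ p.2).card ≤ S.card ^ 2 :=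
    (Finset.card_filter_le _ _).trans (by rw [Finset.card_product, sq])
  exact_mod_cast this

lemma seedMeasure_isLow (i m : ℕ) : seedMeasure {x | IsLow m (levelSeed i x)} = 2⁻¹ ^ m := by
  classical
  have hset : {x : Seed | IsLow m (levelSeed i x)} =
      Set.pi ((Finset.range m).image (Nat.pair i) : Finset ℕ) fun _ => {false} := by
    ext x
    simp [IsLow, levelSeed, Set.mem_pi]
  rw [hset, seedMeasure, Measure.infinitePi_pi _ fun _ _ => measurableSet_singleton _]
  simp only [coin_singleton, Finset.prod_const]
  rw [Finset.card_image_of_injective _ fun a b h => (Nat.pair_eq_pair.1 h).2, Finset.card_range]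

lemma measurableSet_isLow (i m : ℕ) : MeasurableSet {x | IsLow m (levelSeed i x)} := by
  have : {x : Seed | IsLow m (levelSeed i x)} = ⋂ k ∈ Finset.range m,
      (fun x : Seed => x (Nat.pair i k)) ⁻¹' {false} := by
    ext x
    simp [IsLow, levelSeed]
  rw [this]
  exact Finset.measurableSet_biInter _ fun k _ =>
    measurable_pi_apply _ (measurableSet_singleton _)

lemma measure_isLow (v : V) (i m : ℕ) :
    iidMeasure V {ω | IsLow m (levelSeed i (ω v))} = 2⁻¹ ^ m := by
  rw [← seedMeasure_isLow i m, ← Measure.infinitePi_map_eval (fun _ : V => seedMeasure) v,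
    Measure.map_apply (by fun_prop) (measurableSet_isLow i m)]
  rfl

lemma measure_forall_not_isLow (i m : ℕ) (S : Finset V) :
    iidMeasure V {ω | ∀ w ∈ S, ¬IsLow m (levelSeed i (ω w))} = (1 - 2⁻¹ ^ m) ^ S.card := by
  have hset : {ω : V → Seed | ∀ w ∈ S, ¬IsLow m (levelSeed i (ω w))} =
      Set.pi S fun _ => {x | IsLow m (levelSeed i x)}ᶜ := by
    ext ω
    simp [Set.mem_pi]
  rw [hset, iidMeasure, Measure.infinitePi_pi _ fun _ _ => (measurableSet_isLow i m).compl,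
    Finset.prod_const, prob_compl_eq_one_sub (measurableSet_isLow i m), seedMeasure_isLow]

/-- Relabelling the vertices preserves the law of the strings. -/
lemma measurePreserving_comp_equiv (e : V ≃ V) :
    MeasurePreserving (fun ω : V → Seed => ω ∘ e) (iidMeasure V) (iidMeasure V) := by
  refine ⟨by fun_prop, ?_⟩
  have h := Measure.infinitePi_map_piCongrLeft (fun _ : V => seedMeasure) e.symm
  rw [iidMeasure]
  convert h using 2
  ext ω v : 2
  have := Equiv.piCongrLeft_apply_apply (fun _ : V => Seed) e.symm ω (e v)
  rw [MeasurableEquiv.coe_piCongrLeft]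
  simpa using this.symm

end Independence

/-! ### The density of the levels -/

section Density

open SimpleGraph ProbabilityTheory
open scoped ENNReal

variable {V : Type u} {G : SimpleGraph V} {B Δ : ℕ}

/-- The ball as a finite set. -/
def ballFinset (G : SimpleGraph V) [G.LocallyFinite] (v : V) (n : ℕ) : Finset V :=
  (finite_ball (G := G) v n).toFinset

lemma mem_ballFinset [G.LocallyFinite] {v w : V} {n : ℕ} :
    w ∈ ballFinset G v n ↔ w ∈ ball G v n := Set.Finite.mem_toFinset _

lemma card_ballFinset_le [G.LocallyFinite] (hreg : G.IsRegularOfDegree Δ) (v : V) (n : ℕ) :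
    (ballFinset G v n).card ≤ (Δ + 1) ^ n := by
  classical
  induction n with
  | zero =>
    rw [pow_zero, Finset.card_le_one]
    intro a ha b hb
    obtain ⟨p, hp⟩ := mem_ball_iff.1 (mem_ballFinset.1 ha)
    obtain ⟨q, hq⟩ := mem_ball_iff.1 (mem_ballFinset.1 hb)
    rw [← Walk.eq_of_length_eq_zero (Nat.le_zero.1 hp), ← Walk.eq_of_length_eq_zero (Nat.le_zero.1 hq)]
  | succ n ih =>
    have hsub : ballFinset G v (n + 1) ⊆
        (ballFinset G v n).biUnion fun w => insert w (G.neighborFinset w) := by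
      intro w hw
      obtain ⟨p, hp⟩ := mem_ball_iff.1 (mem_ballFinset.1 hw)
      rw [Finset.mem_biUnion]
      by_cases hn : p.Nil
      · refine ⟨w, ?_, Finset.mem_insert_self _ _⟩
        rw [mem_ballFinset, ← hn.eq]
        exact self_mem_ball _ _
      · refine ⟨p.penultimate, mem_ballFinset.2 (mem_ball_iff.2 ⟨p.dropLast, by simp; omega⟩), ?_⟩
        exact Finset.mem_insert_of_mem ((mem_neighborFinset _ _ _).2 (p.adj_penultimate hn))
    refine (Finset.card_le_card hsub).trans (Finset.card_biUnion_le.trans ?_)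
    refine (Finset.sum_le_card_nsmul _ _ (Δ + 1) fun w _ => ?_).trans ?_
    · refine (Finset.card_insert_le _ _).trans ?_
      rw [card_neighborFinset_eq_degree, hreg]
    · rw [smul_eq_mul, pow_succ]
      gcongr

lemma matches_level_of_bits [G.LocallyFinite] {ω ω' : V → Seed} {v : V} {i r j : ℕ} (hij : i ≤ j)
    (h : ∀ p ∈ ballFinset G v (r + levelRadius B i) ×ˢ bitsBelow B j, ω p.1 p.2 = ω' p.1 p.2) :
    Matches (RelEmbedding.refl G.Adj) (ball G v r) (level B G ω i) (level B G ω' i) where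
  subset_range := fun w _ => ⟨w, rfl⟩
  mem_iff _ hw := mem_level_iff_of_bits i fun a ha k hk => h (a, k) <|
    Finset.mk_mem_product (mem_ballFinset.2 (mem_ball_trans hw ha))
      (Finset.biUnion_subset_biUnion_of_subset_left _ (Finset.range_mono hij) hk)

lemma levelLabel_eq_of_bits [G.LocallyFinite] {ω ω' : V → Seed} {v : V} {i r : ℕ}
    (h : ∀ p ∈ ballFinset G v (r + levelRadius B i) ×ˢ bitsBelow B (i + 1),
      ω p.1 p.2 = ω' p.1 p.2) (w : V) (hw : w ∈ ball G v r) :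
    levelLabel B i (ω w) = levelLabel B i (ω' w) :=
  levelLabel_congr_of_bitsBelow (fun k hk => h (w, k) <|
    Finset.mk_mem_product (mem_ballFinset.2 (ball_mono (Nat.le_add_right _ _) hw)) hk) i
      (Nat.lt_succ_self i)

lemma dependsOnBits_mem_trail [G.LocallyFinite] (i : ℕ) (s v : V) :
    DependsOnBits (ballFinset G s (2 * arcLength B i + 1 + levelRadius B i) ×ˢ bitsBelow B (i + 1))
      fun ω => v ∈ trail G (level B G ω i) (fun w => levelLabel B i (ω w)) (arcLength B i) s :=
  fun ω ω' h => (matches_level_of_bits (Nat.le_succ i) h).mem_trail_iff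
    (l := fun w => levelLabel B i (ω w)) (l' := fun w => levelLabel B i (ω' w))
    (levelLabel_eq_of_bits h) (s := s) (v := v) subset_rfl

lemma dependsOnBits_mem_centers [G.LocallyFinite] (i : ℕ) (s : V) :
    DependsOnBits (ballFinset G s (2 * arcLength B i + 1 + levelRadius B i) ×ˢ bitsBelow B (i + 1))
      fun ω => s ∈ centers G (level B G ω i) (fun w => levelLabel B i (ω w)) (arcLength B i) :=
  fun ω ω' h => (matches_level_of_bits (Nat.le_succ i) h).mem_centers_iff
    (l := fun w => levelLabel B i (ω w)) (l' := fun w => levelLabel B i (ω' w))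
    (levelLabel_eq_of_bits h) (w := s) subset_rfl

/-- The branching vertices ahead of an edge in a level. -/
def AheadSetEq (B : ℕ) (G : SimpleGraph V) (i : ℕ) (s u : V) (S : Finset V) (ω : V → Seed) : Prop :=
  ∀ w, w ∈ S ↔ w ∈ branching G (level B G ω i) ∧ Ahead G (level B G ω i) (arcLength B i) s u w

/-- Only bits of the levels below i enter. The bits that decide which vertices are low at level i
stay fresh. -/
lemma dependsOnBits_aheadSetEq [G.LocallyFinite] (i : ℕ) (s u : V) (S : Finset V) :
    DependsOnBits (ballFinset G s (arcLength B i + 1 + levelRadius B i) ×ˢ bitsBelow B i)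
      (AheadSetEq B G i s u S) := fun ω ω' h => by
  have hM := matches_level_of_bits le_rfl h
  refine forall_congr' fun w => iff_congr Iff.rfl ?_
  have ha : Ahead G (level B G ω i) (arcLength B i) s u w ↔
      Ahead G (level B G ω' i) (arcLength B i) s u w :=
    hM.ahead_iff (s := s) (u := u) (w := w) (ball_mono (Nat.le_succ _))
  rw [← ha]
  exact and_congr_left fun hw =>
    hM.mem_branching_iff (w := w) (ball_subset_ball hw.mem_ball le_rfl)

/-- No branching vertex ahead of the edge from `s` to `u` is low. -/
def NoLowAhead (B : ℕ) (G : SimpleGraph V) (i : ℕ) (s u : V) (ω : V → Seed) : Prop :=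
  s ∈ level B G ω i ∧ u ∈ level B G ω i ∧ G.Adj s u ∧
    ∀ w ∈ branching G (level B G ω i), Ahead G (level B G ω i) (arcLength B i) s u w →
      ¬IsLow (lowBits B i) (levelSeed i (ω w))

lemma disjoint_bitsBelow_ownBits (i : ℕ) : Disjoint (bitsBelow B i) (ownBits B i) := by
  refine Finset.disjoint_left.2 fun k hk hk' => ?_
  obtain ⟨j, hj, hk⟩ := Finset.mem_biUnion.1 hk
  obtain ⟨a, -, ha⟩ := Finset.mem_image.1 hk
  obtain ⟨b, -, hb⟩ := Finset.mem_image.1 hk'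
  have := (Nat.pair_eq_pair.1 (ha.trans hb.symm)).1
  exact (Finset.mem_range.1 hj).ne this

lemma dependsOnBits_forall_not_isLow (i : ℕ) (S : Finset V) :
    DependsOnBits (S ×ˢ ownBits B i)
      fun ω => ∀ w ∈ S, ¬IsLow (lowBits B i) (levelSeed i (ω w)) := fun _ _ h =>
  forall₂_congr fun w hw => not_congr <|
    isLow_congr fun k hk => h (w, k) (Finset.mk_mem_product hw hk)

/-- The event is split according to the set of branching vertices ahead. That set is independent of
which vertices are low and has at least 2^(8b) - 1 elements. -/
lemma measure_noLowAhead_le (hB : 9 ≤ B) (hΔ : 3 ≤ Δ) (hG : G.IsAcyclic) [G.LocallyFinite]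
    (hreg : G.IsRegularOfDegree Δ) (i : ℕ) (s u : V) :
    iidMeasure V {ω | NoLowAhead B G i s u ω} ≤
      (1 - 2⁻¹ ^ lowBits B i) ^ (2 ^ (8 * scale B i) - 1) := by
  classical
  set N := 2 ^ (8 * scale B i) - 1 with hN
  set 𝒮 := (ballFinset G s (arcLength B i)).powerset.filter fun S => N ≤ S.card with h𝒮
  have hsub : {ω | NoLowAhead B G i s u ω} ⊆ ⋃ S ∈ 𝒮, ({ω | AheadSetEq B G i s u S ω} ∩
      {ω | ∀ w ∈ S, ¬IsLow (lowBits B i) (levelSeed i (ω w))}) := by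
    rintro ω ⟨hs, hu, hadj, hlow⟩
    set S := (ballFinset G s (arcLength B i)).filter fun w =>
      w ∈ branching G (level B G ω i) ∧ Ahead G (level B G ω i) (arcLength B i) s u w with hS
    have hmem : AheadSetEq B G i s u S ω := fun w => by
      rw [hS, Finset.mem_filter, mem_ballFinset]
      exact and_iff_right_of_imp fun h => h.2.mem_ball
    obtain ⟨F, hF, hF'⟩ := (isBranchy_level hB hΔ hreg ω i).exists_finset_ahead hG
      (8 * scale B i) s hs u hu hadj
    -- 8b doublings, each over a distance of at most 8b: this is where 64b² comes from.
    have hlen : 8 * scale B i * (8 * scale B i) = arcLength B i := by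
      rw [arcLength]
      ring
    rw [hlen] at hF'
    have hcard : F.card ≤ S.card := Finset.card_le_card fun w hw => (hmem w).2 (hF' w hw)
    refine Set.mem_biUnion (x := S) ?_ ⟨hmem, fun w hw => ?_⟩
    · rw [h𝒮, Finset.mem_coe, Finset.mem_filter, Finset.mem_powerset]
      exact ⟨Finset.filter_subset _ _, by omega⟩
    · exact hlow w ((hmem w).1 hw).1 ((hmem w).1 hw).2
  have hmeas : ∀ S, MeasurableSet {ω | AheadSetEq B G i s u S ω} := fun S =>
    (dependsOnBits_aheadSetEq i s u S).measurableSet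
  calc iidMeasure V {ω | NoLowAhead B G i s u ω}
      ≤ ∑ S ∈ 𝒮, iidMeasure V ({ω | AheadSetEq B G i s u S ω} ∩
          {ω | ∀ w ∈ S, ¬IsLow (lowBits B i) (levelSeed i (ω w))}) :=
        (measure_mono hsub).trans (measure_biUnion_finset_le _ _)
    _ ≤ ∑ S ∈ 𝒮, iidMeasure V {ω | AheadSetEq B G i s u S ω} * (1 - 2⁻¹ ^ lowBits B i) ^ N := by
        refine Finset.sum_le_sum fun S hS => ?_
        rw [(dependsOnBits_aheadSetEq i s u S).measure_inter
          (Finset.disjoint_product.2 (Or.inr (disjoint_bitsBelow_ownBits i)))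
          (dependsOnBits_forall_not_isLow i S), measure_forall_not_isLow]
        exact mul_le_mul' le_rfl (pow_le_pow_of_le_one zero_le tsub_le_self
          (Finset.mem_filter.1 hS).2)
    _ ≤ 1 * (1 - 2⁻¹ ^ lowBits B i) ^ N := by
        rw [← Finset.sum_mul]
        gcongr
        -- The events for different sets are disjoint, so their probabilities add up to at most one.
        rw [← measure_univ (μ := iidMeasure V)]
        refine sum_measure_le_measure_univ (fun S _ => (hmeas S).nullMeasurableSet) ?_
        refine fun S _ S' _ hne => (Set.disjoint_left.2 fun ω h h' => hne ?_).aedisjoint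
        exact Finset.ext fun w => (h w).trans (h' w).symm
    _ = _ := one_mul _

/-- A center is low, or it is the target of an edge without low vertices ahead. -/
lemma measure_centers_le (hB : 9 ≤ B) (hΔ : 3 ≤ Δ) (hG : G.IsAcyclic) [G.LocallyFinite]
    (hreg : G.IsRegularOfDegree Δ) (i : ℕ) (v : V) :
    iidMeasure V {ω | v ∈ centers G (level B G ω i) (fun w => levelLabel B i (ω w))
        (arcLength B i)} ≤
      2⁻¹ ^ lowBits B i + ((ballFinset G v (arcLength B i)).card : ℝ≥0∞) * (Δ *
        (1 - 2⁻¹ ^ lowBits B i) ^ (2 ^ (8 * scale B i) - 1)) := by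
  have hsub : {ω | v ∈ centers G (level B G ω i) (fun w => levelLabel B i (ω w))
      (arcLength B i)} ⊆ {ω | IsLow (lowBits B i) (levelSeed i (ω v))} ∪
        ⋃ s ∈ ballFinset G v (arcLength B i), ⋃ u ∈ G.neighborFinset s,
          {ω | NoLowAhead B G i s u ω} := by
    rintro ω ⟨s, u, hw, ha, hmin⟩
    by_cases hlow : IsLow (lowBits B i) (levelSeed i (ω v))
    · exact Or.inl hlow
    refine Or.inr (Set.mem_biUnion (x := s) (mem_ballFinset.2 (mem_ball_comm.1 ha.mem_ball)) ?_)
    have hadj : G.Adj s u := ha.1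
    refine Set.mem_biUnion (x := u) ((mem_neighborFinset _ _ _).2 hadj)
      ⟨ha.start_mem, ha.snd_mem, hadj, fun w hw ha' hlow' => ?_⟩
    have := hmin w hw ha'
    simp [levelLabel, hlow, hlow'] at this
  refine (measure_mono hsub).trans ((measure_union_le _ _).trans ?_)
  rw [measure_isLow]
  gcongr
  refine (measure_biUnion_finset_le _ _).trans ?_
  rw [← nsmul_eq_mul]
  refine Finset.sum_le_card_nsmul _ _ _ fun s _ => (measure_biUnion_finset_le _ _).trans ?_
  rw [← hreg s, ← G.card_neighborFinset_eq_degree, ← nsmul_eq_mul]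
  exact Finset.sum_le_card_nsmul _ _ _ fun u _ => measure_noLowAhead_le hB hΔ hG hreg i s u

lemma eq_of_isPath (hG : G.IsAcyclic) {a b : V} {p q : G.Walk a b} (hp : p.IsPath)
    (hq : q.IsPath) : p = q :=
  congrArg Subtype.val <| (hG.subsingleton_path a b).elim ⟨p, hp⟩ ⟨q, hq⟩

/-- A trail is small if the targets of its center are unique. -/
lemma card_le_of_subset_trail (hG : G.IsAcyclic) [G.LocallyFinite]
    (hreg : G.IsRegularOfDegree Δ) {X : Set V} {l : V → WithTop ℕ} {t : ℕ} {s : V}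
    (huniq : ∀ u w w', IsTarget G X l t s u w → IsTarget G X l t s u w' → w = w')
    (S : Finset V) (hS : ∀ v ∈ S, v ∈ trail G X l t s) : S.card ≤ Δ * (t + 1) := by
  classical
  have hex : ∀ u, ∃ F : Finset V, F.card ≤ t + 1 ∧ ∀ w, IsTarget G X l t s u w →
      ∀ (h : G.Adj s u) (q : G.Walk u w), IsArc G X t (.cons h q) →
        ∀ v ∈ (Walk.cons h q).support, v ∈ F := by
    intro u
    by_cases hu : ∃ w, IsTarget G X l t s u w
    · obtain ⟨w, hw⟩ := hu
      obtain ⟨h, q, hq⟩ := hw.2.1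
      refine ⟨(Walk.cons h q).support.toFinset, ?_, fun w' hw' h' q' hq' v hv => ?_⟩
      · refine (List.toFinset_card_le _).trans ?_
        rw [Walk.length_support]
        exact Nat.succ_le_succ hq.2.1
      · obtain rfl := huniq u w w' hw hw'
        rw [eq_of_isPath hG hq.1 hq'.1]
        exact List.mem_toFinset.2 hv
    · exact ⟨∅, by simp, fun w hw => absurd ⟨w, hw⟩ hu⟩
  choose F hF hF' using hex
  have hsub : S ⊆ (G.neighborFinset s).biUnion F := by
    intro v hv
    obtain ⟨-, u, w, hw, h, q, hq, hv⟩ := hS v hv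
    exact Finset.mem_biUnion.2 ⟨u, (mem_neighborFinset _ _ _).2 h, hF' u w hw h q hq v hv⟩
  refine (Finset.card_le_card hsub).trans (Finset.card_biUnion_le.trans ?_)
  rw [← hreg s, ← G.card_neighborFinset_eq_degree, ← smul_eq_mul]
  exact Finset.sum_le_card_nsmul _ _ _ fun u _ => hF u

/-- The exceptional event that some target of `v` may fail to be unique. -/
def BadTrail (B : ℕ) (G : SimpleGraph V) [G.LocallyFinite] (i : ℕ) (v : V) : Set (V → Seed) :=
  {ω | ∃ a ∈ ballFinset G v (arcLength B i), ∃ b ∈ ballFinset G v (arcLength B i),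
      key (keyBits B i) (levelSeed i (ω a)) = key (keyBits B i) (levelSeed i (ω b)) ∧ a ≠ b} ∪
    ⋃ u ∈ G.neighborFinset v, {ω | NoLowAhead B G i v u ω}

/-- A low vertex ahead forces every minimiser to be low, since all other labels are ⊤. Labels of low
vertices are keys, and outside the bad event these are distinct in the ball. -/
lemma isTarget_unique_of_notMem_badTrail [G.LocallyFinite] {i : ℕ} {v : V} {ω : V → Seed}
    (hω : ω ∉ BadTrail B G i v) {u w w' : V}
    (hw : IsTarget G (level B G ω i) (fun w => levelLabel B i (ω w)) (arcLength B i) v u w)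
    (hw' : IsTarget G (level B G ω i) (fun w => levelLabel B i (ω w)) (arcLength B i) v u w') :
    w = w' := by
  have hadj : G.Adj v u := hw.2.1.1
  obtain ⟨z, hz, hzA, hzL⟩ : ∃ z ∈ branching G (level B G ω i),
      Ahead G (level B G ω i) (arcLength B i) v u z ∧
        IsLow (lowBits B i) (levelSeed i (ω z)) := by
    by_contra! hcon
    exact hω (Or.inr (Set.mem_biUnion (x := u) ((mem_neighborFinset _ _ _).2 hadj)
      ⟨hw.2.1.start_mem, hw.2.1.snd_mem, hadj, hcon⟩))
  have hlow : ∀ {y}, IsTarget G (level B G ω i) (fun w => levelLabel B i (ω w))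
      (arcLength B i) v u y → IsLow (lowBits B i) (levelSeed i (ω y)) := by
    intro y hy
    by_contra hny
    have := hy.2.2 z hz hzA
    simp [levelLabel, hny, hzL] at this
  have heq := le_antisymm (hw.2.2 w' hw'.1 hw'.2.1) (hw'.2.2 w hw.1 hw.2.1)
  simp only [levelLabel, hlow hw, hlow hw', if_true] at heq
  by_contra hne
  exact hω (Or.inl ⟨w, mem_ballFinset.2 hw.2.1.mem_ball, w', mem_ballFinset.2 hw'.2.1.mem_ball,
    by exact_mod_cast heq, hne⟩)

lemma measure_badTrail_le (hB : 9 ≤ B) (hΔ : 3 ≤ Δ) (hG : G.IsAcyclic) [G.LocallyFinite]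
    (hreg : G.IsRegularOfDegree Δ) (i : ℕ) (v : V) :
    iidMeasure V (BadTrail B G i v) ≤
      ((ballFinset G v (arcLength B i)).card : ℝ≥0∞) ^ 2 * 2⁻¹ ^ keyBits B i +
        Δ * (1 - 2⁻¹ ^ lowBits B i) ^ (2 ^ (8 * scale B i) - 1) := by
  refine (measure_union_le _ _).trans (add_le_add ?_ ?_)
  · exact measure_exists_tie_le (fun n x => key n (levelSeed i x)) _
      (fun a b h => measure_level_key_eq h i _) _
  · refine (measure_biUnion_finset_le _ _).trans ?_
    rw [← hreg v, ← G.card_neighborFinset_eq_degree, ← nsmul_eq_mul]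
    exact Finset.sum_le_card_nsmul _ _ _ fun u _ => measure_noLowAhead_le hB hΔ hG hreg i v u

/-- The expected size of a trail. -/
lemma sum_measure_mem_trail_le (hG : G.IsAcyclic) [G.LocallyFinite]
    (hreg : G.IsRegularOfDegree Δ) (i : ℕ) (v : V) :
    ∑ s ∈ ballFinset G v (arcLength B i), iidMeasure V {ω | s ∈ trail G (level B G ω i)
        (fun w => levelLabel B i (ω w)) (arcLength B i) v} ≤
      (Δ * (arcLength B i + 1) : ℕ) * iidMeasure V {ω | v ∈ centers G (level B G ω i)
        (fun w => levelLabel B i (ω w)) (arcLength B i)} +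
      (ballFinset G v (arcLength B i)).card * iidMeasure V (BadTrail B G i v) := by
  classical
  set T : V → Set (V → Seed) := fun s => {ω | s ∈ trail G (level B G ω i)
        (fun w => levelLabel B i (ω w)) (arcLength B i) v} with hT
  set C : Set (V → Seed) := {ω | v ∈ centers G (level B G ω i)
        (fun w => levelLabel B i (ω w)) (arcLength B i)} with hC
  have hTm : ∀ s, MeasurableSet (T s) := fun s => (dependsOnBits_mem_trail i v s).measurableSet
  have hCm : MeasurableSet C := (dependsOnBits_mem_centers i v).measurableSet
  calc ∑ s ∈ ballFinset G v (arcLength B i), iidMeasure V (T s)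
      = ∫⁻ ω, ∑ s ∈ ballFinset G v (arcLength B i), (T s).indicator 1 ω ∂iidMeasure V := by
        rw [lintegral_finsetSum _ fun s _ => measurable_one.indicator (hTm s)]
        exact Finset.sum_congr rfl fun s _ => (lintegral_indicator_one (hTm s)).symm
    _ ≤ ∫⁻ ω, (C.indicator (fun _ => ((Δ * (arcLength B i + 1) : ℕ) : ℝ≥0∞)) ω +
          (BadTrail B G i v).indicator
            (fun _ => ((ballFinset G v (arcLength B i)).card : ℝ≥0∞)) ω) ∂iidMeasure V := by
        refine lintegral_mono fun ω => ?_
        have hsum : ∑ s ∈ ballFinset G v (arcLength B i), (T s).indicator 1 ω =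
            (((ballFinset G v (arcLength B i)).filter fun s => ω ∈ T s).card : ℝ≥0∞) := by
          rw [Finset.card_filter, Nat.cast_sum]
          exact Finset.sum_congr rfl fun s _ => by simp [Set.indicator_apply]
        rw [hsum]
        -- On the bad event the trail is bounded only by the whole ball; off it, the trail is short,
        -- and empty unless `v` is a center.
        by_cases hbad : ω ∈ BadTrail B G i v
        · rw [Set.indicator_of_mem hbad]
          refine le_add_left ?_
          exact_mod_cast Finset.card_filter_le _ _
        · by_cases hc : ω ∈ C
          · rw [Set.indicator_of_mem hc]
            refine le_add_right ?_
            exact_mod_cast card_le_of_subset_trail hG hreg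
              (fun u w w' => isTarget_unique_of_notMem_badTrail hbad) _
                fun s hs => (Finset.mem_filter.1 hs).2
          · rw [Finset.filter_false_of_mem fun s _ hs => hc hs.1]
            simp
    _ ≤ _ := by
        rw [lintegral_add_left (measurable_const.indicator hCm)]
        exact add_le_add (lintegral_indicator_const_le _ _) (lintegral_indicator_const_le _ _)

/-- Mass transport: the roles of the two vertices may be exchanged. -/
lemma measure_mem_trail_comm (hG : G.IsTree) [G.LocallyFinite] (hreg : G.IsRegularOfDegree Δ)
    (i : ℕ) (s v : V) :
    iidMeasure V {ω | v ∈ trail G (level B G ω i) (fun w => levelLabel B i (ω w))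
      (arcLength B i) s} =
    iidMeasure V {ω | s ∈ trail G (level B G ω i) (fun w => levelLabel B i (ω w))
      (arcLength B i) v} := by
  obtain ⟨φ, h1, h2⟩ := exists_iso_swap hG hreg s v
  rw [← (measurePreserving_comp_equiv φ.toEquiv).measure_preimage
    (dependsOnBits_mem_trail i v s).measurableSet.nullMeasurableSet]
  congr 1
  ext ω
  have hM : Matches φ.toEmbedding Set.univ (level B G (ω ∘ φ) i) (level B G ω i) := by
    have h := matches_level (B := B) φ.toEmbedding (x := ω ∘ φ) (y := ω) (D := Set.univ)
      (fun w _ => φ.surjective w) i fun _ _ _ _ => rfl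
    exact ⟨fun w _ => φ.surjective w, fun w _ => h.mem_iff w (Set.subset_univ _)⟩
  have := hM.mem_trail_iff (l := fun w => levelLabel B i ((ω ∘ φ) w))
    (l' := fun w => levelLabel B i (ω w)) (t := arcLength B i) (fun _ _ => rfl) (s := v) (v := s)
    (Set.subset_univ _)
  have h1' : φ.toEmbedding s = v := h1
  have h2' : φ.toEmbedding v = s := h2
  rw [h1', h2'] at this
  exact this.symm

/-- The probability is at most the expected number of trails through `v`, which by mass transport
equals the expected size of the trail of `v`. -/
lemma measure_level_succ_le (hB : 9 ≤ B) (hΔ : 3 ≤ Δ) (hG : G.IsTree) [G.LocallyFinite]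
    (hreg : G.IsRegularOfDegree Δ) (i : ℕ) (v : V) :
    iidMeasure V {ω | v ∈ level B G ω (i + 1)} ≤
      (Δ * (arcLength B i + 1) : ℕ) *
        (2⁻¹ ^ lowBits B i + ((ballFinset G v (arcLength B i)).card : ℝ≥0∞) * (Δ *
          (1 - 2⁻¹ ^ lowBits B i) ^ (2 ^ (8 * scale B i) - 1))) +
      (ballFinset G v (arcLength B i)).card *
        (((ballFinset G v (arcLength B i)).card : ℝ≥0∞) ^ 2 * 2⁻¹ ^ keyBits B i +
          Δ * (1 - 2⁻¹ ^ lowBits B i) ^ (2 ^ (8 * scale B i) - 1)) := by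
  have hsub : {ω | v ∈ level B G ω (i + 1)} ⊆ ⋃ s ∈ ballFinset G v (arcLength B i),
      {ω | v ∈ trail G (level B G ω i) (fun w => levelLabel B i (ω w)) (arcLength B i) s} := by
    rintro ω ⟨s, hs⟩
    exact Set.mem_biUnion (x := s)
      (mem_ballFinset.2 (mem_ball_comm.1 (mem_ball_of_mem_trail hs))) hs
  refine (measure_mono hsub).trans ((measure_biUnion_finset_le _ _).trans ?_)
  simp_rw [measure_mem_trail_comm hG hreg i _ v]
  refine (sum_measure_mem_trail_le hG.isAcyclic hreg i v).trans ?_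
  gcongr
  · exact measure_centers_le hB hΔ hG.isAcyclic hreg i v
  · exact measure_badTrail_le hB hΔ hG.isAcyclic hreg i v

end Density

/-! ### Estimates -/

section Estimates

open SimpleGraph
open scoped ENNReal

variable {B Δ : ℕ}

lemma half_mul_two_pow (k : ℕ) : (2 : ℝ≥0∞) ^ k * 2⁻¹ ^ k = 1 := by
  rw [← mul_pow, ENNReal.mul_inv_cancel two_ne_zero ENNReal.ofNat_ne_top, one_pow]

lemma cast_mul_half_pow_le {A k x y : ℕ} (hA : A ≤ 2 ^ k) (h : k + y ≤ x) :
    (A : ℝ≥0∞) * 2⁻¹ ^ x ≤ 2⁻¹ ^ y := by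
  have hhalf : (2⁻¹ : ℝ≥0∞) ≤ 1 := ENNReal.inv_le_one.2 one_le_two
  calc (A : ℝ≥0∞) * 2⁻¹ ^ x ≤ 2 ^ k * 2⁻¹ ^ (k + y) :=
        mul_le_mul' (by exact_mod_cast hA) (pow_le_pow_of_le_one zero_le hhalf h)
    _ = 2⁻¹ ^ y := by rw [pow_add, ← mul_assoc, half_mul_two_pow, one_mul]

/-- With q = 2^(-a) and N = 2^a, Bernoulli gives (1 + q)^N ≥ 2, while (1 - q)^N (1 + q)^N ≤ 1. -/
lemma one_sub_half_pow_le (a : ℕ) : (1 - 2⁻¹ ^ a : ℝ≥0∞) ^ 2 ^ a ≤ 2⁻¹ := by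
  set q : ℝ := 2⁻¹ ^ a with hq
  have hq0 : 0 ≤ q := by positivity
  have hq1 : q ≤ 1 := pow_le_one₀ (by norm_num) (by norm_num)
  have hENN : (1 - 2⁻¹ ^ a : ℝ≥0∞) = ENNReal.ofReal (1 - q) := by
    rw [ENNReal.ofReal_sub _ hq0, ENNReal.ofReal_one, hq, ENNReal.ofReal_pow (by norm_num),
      ENNReal.ofReal_inv_of_pos (by norm_num)]
    simp
  have h2 : (2 : ℝ) ^ a * q = 1 := by
    rw [hq, ← mul_pow]
    norm_num
  have hreal : (1 - q) ^ 2 ^ a ≤ 2⁻¹ := by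
    have h1 : 1 + ((2 ^ a : ℕ) : ℝ) * q ≤ (1 + q) ^ 2 ^ a :=
      one_add_mul_le_pow (by linarith) _
    have h3 : (1 - q) ^ 2 ^ a * (1 + q) ^ 2 ^ a ≤ 1 := by
      rw [← mul_pow]
      exact pow_le_one₀ (by nlinarith) (by nlinarith)
    have h4 : 0 ≤ (1 - q) ^ 2 ^ a := by
      have : 0 ≤ 1 - q := by linarith
      positivity
    push_cast at h1
    nlinarith
  rw [hENN, ← ENNReal.ofReal_pow (by linarith)]
  refine (ENNReal.ofReal_le_ofReal hreal).trans ?_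
  rw [ENNReal.ofReal_inv_of_pos (by norm_num)]
  simp

/-- The exponent contains b³ blocks of length 2^(4b), and each block contributes a factor of at most
1/2. -/
lemma one_sub_half_pow_le' {b : ℕ} :
    (1 - 2⁻¹ ^ (4 * b) : ℝ≥0∞) ^ (2 ^ (8 * b) - 1) ≤ 2⁻¹ ^ b ^ 3 := by
  have h1 : b ^ 3 + 1 ≤ 2 ^ (4 * b) := by
    have h : b + 1 ≤ 2 ^ b := Nat.lt_two_pow_self
    calc b ^ 3 + 1 ≤ (b + 1) ^ 4 := by ring_nf; nlinarith [Nat.zero_le (b ^ 4)]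
      _ ≤ (2 ^ b) ^ 4 := by gcongr
      _ = 2 ^ (4 * b) := by rw [← pow_mul, mul_comm]
  have h2 : 2 ^ (4 * b) * b ^ 3 ≤ 2 ^ (8 * b) - 1 := by
    have h3 : 2 ^ (8 * b) = 2 ^ (4 * b) * 2 ^ (4 * b) := by rw [← pow_add]; congr 1; ring
    have h4 : 2 ^ (4 * b) * (b ^ 3 + 1) ≤ 2 ^ (4 * b) * 2 ^ (4 * b) := Nat.mul_le_mul_left _ h1
    have h5 : 1 ≤ 2 ^ (4 * b) := Nat.one_le_two_pow
    rw [h3, mul_add] at *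
    omega
  calc (1 - 2⁻¹ ^ (4 * b) : ℝ≥0∞) ^ (2 ^ (8 * b) - 1)
      ≤ (1 - 2⁻¹ ^ (4 * b) : ℝ≥0∞) ^ (2 ^ (4 * b) * b ^ 3) :=
        pow_le_pow_of_le_one zero_le tsub_le_self h2
    _ = ((1 - 2⁻¹ ^ (4 * b) : ℝ≥0∞) ^ 2 ^ (4 * b)) ^ b ^ 3 := pow_mul _ _ _
    _ ≤ 2⁻¹ ^ b ^ 3 := by
        gcongr
        exact one_sub_half_pow_le _

/-- In the main term a polynomial in b competes with 2^(-4b). In the error terms, factors of at most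
2^(64(Δ+1)b²), four of them at worst, compete with 2^(-b³); since 300 exceeds 4 · 64, the cube wins.
Each of the two parts is at most 2^(-(b+1)). -/
lemma density_estimate {b c : ℕ} (hb : 300 * (Δ + 1) ≤ b) (hc : c ≤ (Δ + 1) ^ (64 * b ^ 2))
    (hΔ : 3 ≤ Δ) {r e : ℝ≥0∞} (hr : r ≤ e) (he : e = 2⁻¹ ^ b ^ 3) :
    (Δ * (64 * b ^ 2 + 1) : ℕ) * (2⁻¹ ^ (4 * b) + (c : ℝ≥0∞) * (Δ * r)) +
      c * ((c : ℝ≥0∞) ^ 2 * e + Δ * r) ≤ 2⁻¹ ^ b := by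
  set P := (Δ + 1) ^ (64 * b ^ 2) with hP
  set g := (Δ + 1) * (64 * b ^ 2) with hg
  have hb2 : b ^ 2 * 300 * (Δ + 1) ≤ b ^ 3 := by
    calc b ^ 2 * 300 * (Δ + 1) = b ^ 2 * (300 * (Δ + 1)) := by ring
      _ ≤ b ^ 2 * b := Nat.mul_le_mul_left _ hb
      _ = b ^ 3 := by ring
  have hPg : P ≤ 2 ^ g := by
    rw [hP, hg, pow_mul 2]
    exact Nat.pow_le_pow_left Nat.lt_two_pow_self.le _
  have hΔP : Δ ≤ P := (Nat.le_succ Δ).trans (Nat.le_self_pow (Nat.mul_ne_zero (by norm_num) (pow_ne_zero 2 (by omega))) _)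
  have htP : 64 * b ^ 2 + 1 ≤ P := Nat.lt_pow_self (by omega)
  have hP1 : 1 ≤ P := Nat.one_le_pow _ _ (by omega)
  have hfirst : ((Δ * (64 * b ^ 2 + 1) : ℕ) : ℝ≥0∞) * 2⁻¹ ^ (4 * b) ≤ 2⁻¹ ^ (b + 1) := by
    refine cast_mul_half_pow_le (k := 3 * b - 3) ?_ (by omega)
    have h1 : b ≤ 2 ^ (b - 1) := by
      have : b - 1 < 2 ^ (b - 1) := Nat.lt_two_pow_self
      omega
    calc Δ * (64 * b ^ 2 + 1) ≤ b ^ 3 := by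
          have : 1 ≤ b ^ 2 := Nat.one_le_pow _ _ (by omega)
          nlinarith
      _ ≤ (2 ^ (b - 1)) ^ 3 := by gcongr
      _ = 2 ^ (3 * b - 3) := by rw [← pow_mul]; congr 1; omega
  have hsecond : ((Δ * (64 * b ^ 2 + 1) * (c * Δ) + c * (c ^ 2 + Δ) : ℕ) : ℝ≥0∞) * e ≤
      2⁻¹ ^ (b + 1) := by
    rw [he]
    refine cast_mul_half_pow_le (k := 4 * g + 2) ?_ ?_
    · calc Δ * (64 * b ^ 2 + 1) * (c * Δ) + c * (c ^ 2 + Δ)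
          ≤ P * P * (P * P) + P * (P ^ 2 + P) := by gcongr
        _ ≤ P ^ 4 * 2 ^ 2 := by nlinarith [Nat.pow_le_pow_right hP1 (by norm_num : 2 ≤ 4),
            Nat.pow_le_pow_right hP1 (by norm_num : 3 ≤ 4)]
        _ ≤ (2 ^ g) ^ 4 * 2 ^ 2 := by gcongr
        _ = 2 ^ (4 * g + 2) := by rw [← pow_mul, ← pow_add]; congr 1; ring
    · have h3 : b * 900 ≤ b ^ 3 := by nlinarith [Nat.pow_le_pow_left hb 2]
      rw [hg]
      nlinarith
  have hhalf : (2⁻¹ : ℝ≥0∞) ^ (b + 1) + 2⁻¹ ^ (b + 1) = 2⁻¹ ^ b := by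
    rw [← two_mul, pow_succ, mul_comm (2⁻¹ ^ b), ← mul_assoc,
      ENNReal.mul_inv_cancel two_ne_zero ENNReal.ofNat_ne_top, one_mul]
  rw [← hhalf]
  refine le_trans ?_ (add_le_add hfirst hsecond)
  calc _ ≤ ((Δ * (64 * b ^ 2 + 1) : ℕ) : ℝ≥0∞) * (2⁻¹ ^ (4 * b) + (c : ℝ≥0∞) * (Δ * e)) +
      c * ((c : ℝ≥0∞) ^ 2 * e + Δ * e) := by gcongr
    _ = _ := by
      push_cast
      ring

lemma measure_level_succ_le_half_pow {V : Type u} {G : SimpleGraph V} [G.LocallyFinite]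
    (hB : 300 * (Δ + 1) ≤ B) (hΔ : 3 ≤ Δ) (hG : G.IsTree) (hreg : G.IsRegularOfDegree Δ) (i : ℕ)
    (v : V) : iidMeasure V {ω | v ∈ level B G ω (i + 1)} ≤ 2⁻¹ ^ scale B i :=
  (measure_level_succ_le (by omega) hΔ hG hreg i v).trans <|
    density_estimate (hB.trans (le_scale i)) (card_ballFinset_le hreg v _) hΔ
      one_sub_half_pow_le' rfl

/-- The increment 192b² + 1 is absorbed by the next scale b³. -/
lemma levelRadius_le (hB : 300 ≤ B) (i : ℕ) : levelRadius B i ≤ scale B i := by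
  induction i with
  | zero => exact Nat.zero_le _
  | succ i ih =>
    have h := hB.trans (le_scale (B := B) i)
    rw [levelRadius, scale_succ, arcLength]
    calc levelRadius B i + (3 * (64 * scale B i ^ 2) + 1)
        ≤ 300 * scale B i ^ 2 := by nlinarith
      _ ≤ scale B i * scale B i ^ 2 := by gcongr
      _ = scale B i ^ 3 := by ring

lemma sum_arcLength_le (i : ℕ) : ∑ j ∈ Finset.range i, arcLength B j ≤ levelRadius B i := by
  induction i with
  | zero => simp
  | succ i ih =>
    rw [Finset.sum_range_succ, levelRadius]
    omega

/-- The smallest scale above `y` is polynomial in `y`. -/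
lemma exists_scale (hB : 2 ≤ B) {y : ℕ} (hy : 1 ≤ y) :
    ∃ i, y ≤ scale B i ∧ scale B i ≤ B * y ^ 3 := by
  classical
  have hex : ∃ i, y ≤ scale B i := by
    refine ⟨y, ?_⟩
    have h1 : y < 3 ^ y := Nat.lt_pow_self (by norm_num)
    have h2 : 3 ^ y < B ^ 3 ^ y := Nat.lt_pow_self (by omega)
    rw [scale]
    omega
  refine ⟨Nat.find hex, Nat.find_spec hex, ?_⟩
  rcases hcase : Nat.find hex with _ | i
  · have := Nat.one_le_pow 3 _ hy
    simp only [scale, pow_zero, pow_one]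
    nlinarith
  · have hlt : scale B i < y := not_le.1 (Nat.find_min hex (by omega))
    rw [scale_succ]
    calc scale B i ^ 3 ≤ y ^ 3 := by gcongr
      _ ≤ B * y ^ 3 := Nat.le_mul_of_pos_left _ (by omega)

/-- Outside an event of probability at most `2 * 2⁻ʸ`, both radii are polynomial in `y`. -/
lemma exists_radius_bound (hB : 300 * (Δ + 1) ≤ B) (hB' : 1 ≤ B) (hΔ : 3 ≤ Δ) {y : ℕ}
    (hy : 1 ≤ y) {V : Type u} {G : SimpleGraph V} [G.LocallyFinite] (hG : G.IsTree)
    (hreg : G.IsRegularOfDegree Δ) (v : V) :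
    iidMeasure V {ω | ¬((flowAlgorithm B hB').codingRadius G ω v ≤
        ((4 * Δ + 10) * (B * y ^ 3) ^ 9 : ℕ) ∧
      subtreeRadius (flowAlgorithm B hB') G ω v ≤ ((4 * Δ + 10) * (B * y ^ 3) ^ 9 : ℕ))} ≤
      2 * 2⁻¹ ^ y := by
  obtain ⟨i, hi, hi'⟩ := exists_scale (by omega : 2 ≤ B) hy
  have hs1 : scale B (i + 1) = scale B i ^ 3 := scale_succ i
  have hs2 : scale B (i + 2) = scale B (i + 1) ^ 3 := scale_succ (i + 1)
  -- By step `m` the flow has shrunk into level i + 1.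
  set m := ∑ j ∈ Finset.range (i + 1), arcLength B j with hm
  have hstage : stage B m = (i + 1, arcLength B (i + 1)) := stage_sum hB' (i + 1)
  have hm2 : m ≤ scale B (i + 2) :=
    (sum_arcLength_le _).trans ((levelRadius_le (by omega) _).trans (scale_mono (Nat.le_succ _)))
  have hR : flowRadius B m ≤ 2 * scale B (i + 2) := by
    have h1 : levelRadius B (i + 1 + 1) ≤ scale B (i + 2) := levelRadius_le (by omega) _
    have h2 : arcLength B (i + 1) ≤ scale B (i + 2) := by
      have h := le_scale (B := B) (i + 1)
      rw [arcLength, hs2, pow_succ _ 2, mul_comm]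
      gcongr
      omega
    rw [flowRadius, hstage]
    simp only
    omega
  -- The first summands make the parents visible. The term `2 * ((Δ + 1) * (m + 1))` pays for the
  -- number of pairs in the ball, and `scale B i ≥ y` further bits bring the probability of a tie
  -- down to 2^(-y).
  set n := flowRadius B m + 1 + 2 * ((Δ + 1) * (m + 1)) + scale B i with hn
  -- Two levels up the scale is b^9, and b ≤ B y³.
  have hbound : m + n ≤ (4 * Δ + 10) * (B * y ^ 3) ^ 9 := by
    have h1 : scale B i ≤ scale B (i + 2) := scale_mono (by omega)
    have h2 := one_le_scale hB' (i + 2)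
    have h3 : (Δ + 1) * (m + 1) ≤ (Δ + 1) * (2 * scale B (i + 2)) :=
      Nat.mul_le_mul_left _ (by omega)
    have h4 : m + n ≤ (4 * Δ + 10) * scale B (i + 2) := by
      rw [hn]
      nlinarith
    refine h4.trans ?_
    rw [hs2, hs1, ← pow_mul]
    gcongr
  set S := ballFinset G v (m + 1) with hS
  have hsub : {ω | ¬((flowAlgorithm B hB').codingRadius G ω v ≤
        ((4 * Δ + 10) * (B * y ^ 3) ^ 9 : ℕ) ∧
      subtreeRadius (flowAlgorithm B hB') G ω v ≤ ((4 * Δ + 10) * (B * y ^ 3) ^ 9 : ℕ))} ⊆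
      {ω | v ∈ level B G ω (i + 1)} ∪
        {ω | ∃ a ∈ S, ∃ b ∈ S, key n (ω a) = key n (ω b) ∧ a ≠ b} := by
    intro ω hω
    by_contra hcon
    rw [Set.mem_union, not_or] at hcon
    have hv : v ∉ flow B G ω m := fun h => hcon.1 <| by
      have := flow_subset_level ω m h
      rwa [hstage] at this
    have hkey : ∀ a ∈ ball G v (m + 1), ∀ b ∈ ball G v (m + 1),
        key n (ω a) = key n (ω b) → a = b := by
      intro a ha b hb hab
      by_contra hne
      exact hcon.2 ⟨a, mem_ballFinset.2 ha, b, mem_ballFinset.2 hb, hab, hne⟩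
    refine hω ⟨?_, ?_⟩
    · obtain ⟨u, hu⟩ := exists_isParent (by omega) hΔ hreg hv (n := n) (by omega)
        fun a ha b hb => hkey a (ball_mono (by omega) ha) b (ball_mono (by omega) hb)
      refine (codingRadius_le (answer_ne_none_of_isParent hu)).trans ?_
      exact_mod_cast (Nat.le_add_left n m).trans hbound
    · refine (subtreeRadius_le (determinesSubtree (by omega) hB' hΔ hreg hv (n := n) (by omega)
        hkey)).trans ?_
      exact_mod_cast hbound
  have htie : ((S.card : ℕ) : ℝ≥0∞) ^ 2 * 2⁻¹ ^ n ≤ 2⁻¹ ^ y := by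
    have h := cast_mul_half_pow_le (A := S.card ^ 2) (k := 2 * ((Δ + 1) * (m + 1))) (x := n)
      (y := y) ?_ (by omega)
    · exact_mod_cast h
    · calc S.card ^ 2 ≤ ((Δ + 1) ^ (m + 1)) ^ 2 := by
            gcongr
            exact card_ballFinset_le hreg v _
        _ ≤ ((2 ^ (Δ + 1)) ^ (m + 1)) ^ 2 := by
            gcongr
            exact Nat.lt_two_pow_self.le
        _ = 2 ^ (2 * ((Δ + 1) * (m + 1))) := by
            rw [← pow_mul, ← pow_mul]
            congr 1
            ring
  refine (measure_mono hsub).trans ((measure_union_le _ _).trans ?_)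
  rw [two_mul]
  refine add_le_add ((measure_level_succ_le_half_pow hB hΔ hG hreg i v).trans ?_) ?_
  · exact pow_le_pow_of_le_one zero_le (ENNReal.inv_le_one.2 one_le_two) hi
  · exact (measure_exists_tie_le key n (fun a b h => measure_key_eq h n) S).trans htie

/-- The number of bits of precision that `ε` asks for. -/
def precision (ε : ℝ) : ℕ := ⌈Real.logb 2 (2 / ε)⌉₊

lemma one_le_precision {ε : ℝ} (hε : ε ∈ Set.Ioo (0 : ℝ) 1) : 1 ≤ precision ε := by
  refine Nat.one_le_iff_ne_zero.2 (Nat.ceil_pos.2 ?_).ne'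
  refine Real.logb_pos (by norm_num) ?_
  rw [lt_div_iff₀ hε.1]
  linarith [hε.2]

lemma two_mul_half_pow_precision_le {ε : ℝ} (hε : ε ∈ Set.Ioo (0 : ℝ) 1) :
    (2 : ℝ≥0∞) * 2⁻¹ ^ precision ε ≤ ENNReal.ofReal ε := by
  have hreal : (2 : ℝ) * 2⁻¹ ^ precision ε ≤ ε := by
    have h1 : 2 / ε ≤ 2 ^ precision ε := by
      rw [← Real.rpow_natCast, ← Real.logb_le_iff_le_rpow (by norm_num) (by have := hε.1; positivity)]
      exact Nat.le_ceil _
    rw [inv_pow, ← div_eq_mul_inv, div_le_iff₀ (by positivity)]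
    rwa [div_le_iff₀ hε.1, mul_comm] at h1
  refine le_trans (le_of_eq ?_) (ENNReal.ofReal_le_ofReal hreal)
  rw [ENNReal.ofReal_mul (by norm_num), ENNReal.ofReal_pow (by norm_num),
    ENNReal.ofReal_inv_of_pos (by norm_num)]
  simp

lemma isPolyLog_precision (C k : ℕ) : IsPolyLog fun ε => C * precision ε ^ k + 1 := by
  have hlog : Tendsto (fun ε : ℝ => Real.log (1 / ε)) (𝓝[>] 0) atTop := by
    simp only [one_div]
    exact Real.tendsto_log_atTop.comp tendsto_inv_nhdsGT_zero
  refine ⟨k, IsBigO.of_bound (C * 4 ^ k + 1) ?_⟩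
  filter_upwards [hlog.eventually_ge_atTop 1, self_mem_nhdsWithin] with ε hε h0
  have h0 : 0 < ε := h0
  have hp : (precision ε : ℝ) ≤ 4 * Real.log (1 / ε) := by
    have h2 : Real.logb 2 (2 / ε) = 1 + Real.log (1 / ε) / Real.log 2 := by
      rw [Real.logb, show (2 : ℝ) / ε = 2 * (1 / ε) by ring,
        Real.log_mul (by norm_num) (by positivity), add_div, div_self (Real.log_pos (by norm_num)).ne']
    have h3 : Real.log (1 / ε) / Real.log 2 ≤ 2 * Real.log (1 / ε) := by
      rw [div_le_iff₀ (Real.log_pos (by norm_num))]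
      nlinarith [Real.log_two_gt_d9]
    have h4 : (precision ε : ℝ) < Real.logb 2 (2 / ε) + 1 := by
      refine Nat.ceil_lt_add_one ?_
      rw [h2]
      have := Real.log_pos (by norm_num : (1 : ℝ) < 2)
      positivity
    linarith
  rw [Real.norm_of_nonneg (by positivity), Real.norm_of_nonneg (by positivity)]
  push_cast
  have h5 : (precision ε : ℝ) ^ k ≤ 4 ^ k * Real.log (1 / ε) ^ k := by
    rw [← mul_pow]
    gcongr
  have h6 : 1 ≤ Real.log (1 / ε) ^ k := one_le_pow₀ hε
  nlinarith [mul_le_mul_of_nonneg_left h5 (Nat.cast_nonneg (α := ℝ) C)]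

lemma countable_of_connected {V : Type u} {G : SimpleGraph V} [G.LocallyFinite]
    (hG : G.Connected) : Countable V := by
  obtain ⟨v⟩ := hG.nonempty
  rw [← Set.countable_univ_iff]
  refine (Set.countable_iUnion fun n => (finite_ball (G := G) v n).countable).mono fun w _ => ?_
  obtain ⟨p⟩ := hG.preconnected v w
  exact Set.mem_iUnion.2 ⟨p.length, mem_ball_iff.2 ⟨p, le_rfl⟩⟩

end Estimates

end OneEnded

end

/-! ### Choice of the parameters and proof of the theorem -/

theorem mainTheorem10 (Δ : ℕ) (hΔ : 3 ≤ Δ) :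
    ∃ A : OneEnded.UniformAlgorithm.{u}, ∃ t₁ t₂ : ℝ → ℕ,
      OneEnded.IsPolyLog t₁ ∧ OneEnded.IsPolyLog t₂ ∧
      ∀ (V : Type u) (G : SimpleGraph V) [G.LocallyFinite],
        G.IsTree → G.IsRegularOfDegree Δ →
          (∀ᵐ ω ∂(OneEnded.iidMeasure V),
            OneEnded.IsOneEndedSpanningForest G (A.run G ω)) ∧
          (∀ v : V, ∀ ε ∈ Set.Ioo (0 : ℝ) 1,
            OneEnded.iidMeasure V {ω | (t₁ ε : ℕ∞) ≤ A.codingRadius G ω v} ≤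
              ENNReal.ofReal ε) ∧
          (∀ v : V, ∀ ε ∈ Set.Ioo (0 : ℝ) 1,
            OneEnded.iidMeasure V {ω | (t₂ ε : ℕ∞) < OneEnded.subtreeRadius A G ω v} ≤
              ENNReal.ofReal ε) := by
  obtain ⟨B, hB⟩ : ∃ B, B = 300 * (Δ + 1) := ⟨_, rfl⟩
  have hB' : 1 ≤ B := by omega
  -- 27 = 3 · 9 comes from the bound in `exists_radius_bound`; the `+ 1` puts `t` strictly above
  -- that bound, as the non-strict inequality for the coding radius requires.
  set t : ℝ → ℕ := fun ε => (4 * Δ + 10) * B ^ 9 * OneEnded.precision ε ^ 27 + 1 with ht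
  have hpoly : OneEnded.IsPolyLog t := OneEnded.isPolyLog_precision _ _
  refine ⟨OneEnded.flowAlgorithm B hB', t, t, hpoly, hpoly, fun V G _ hG hreg => ?_⟩
  -- Stated for an arbitrary set `E`, this serves both tails and the event of an infinite coding
  -- radius.
  have hbad : ∀ v : V, ∀ ε ∈ Set.Ioo (0 : ℝ) 1, ∀ E : Set (V → OneEnded.Seed),
      (∀ ω ∈ E, (t ε : ℕ∞) ≤ (OneEnded.flowAlgorithm B hB').codingRadius G ω v ∨
        (t ε : ℕ∞) < OneEnded.subtreeRadius (OneEnded.flowAlgorithm B hB') G ω v) →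
      OneEnded.iidMeasure V E ≤ ENNReal.ofReal ε := by
    intro v ε hε E hE
    refine (measure_mono fun ω hω => ?_).trans
      ((OneEnded.exists_radius_bound (hB ▸ le_rfl) hB' hΔ (OneEnded.one_le_precision hε) hG hreg
        v).trans (OneEnded.two_mul_half_pow_precision_le hε))
    have heq : t ε = (4 * Δ + 10) * (B * OneEnded.precision ε ^ 3) ^ 9 + 1 := by
      simp only [ht]
      ring
    rintro ⟨h1, h2⟩
    rcases hE ω hω with h | h
    · have := h.trans h1
      rw [heq] at this
      norm_cast at this
      omega
    · have := h.trans_le h2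
      rw [heq] at this
      norm_cast at this
      omega
  refine ⟨?_, fun v ε hε => hbad v ε hε _ fun ω h => Or.inl h,
    fun v ε hε => hbad v ε hε _ fun ω h => Or.inr h⟩
  have := OneEnded.countable_of_connected hG.connected
  have hfin : ∀ v : V, ∀ᵐ ω ∂(OneEnded.iidMeasure V),
      (OneEnded.flowAlgorithm B hB').codingRadius G ω v ≠ ⊤ := by
    intro v
    rw [ae_iff]
    refine le_antisymm (ENNReal.le_of_forall_pos_le_add fun ε hε _ => ?_) zero_le
    rw [zero_add]
    -- The tail bound is available only for parameters below 1, whereas `ε` is an arbitrary positive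
    -- number here.
    have hmin : min (ε : ℝ) (1 / 2) ∈ Set.Ioo (0 : ℝ) 1 :=
      ⟨lt_min hε (by norm_num), (min_le_right _ _).trans_lt (by norm_num)⟩
    refine (hbad v _ hmin _ fun ω hω => Or.inl ?_).trans ?_
    · rw [not_not.1 hω]
      exact le_top
    · refine (ENNReal.ofReal_le_ofReal (min_le_left _ _)).trans ?_
      rw [ENNReal.ofReal_coe_nnreal]
  filter_upwards [ae_all_iff.2 hfin] with ω hω
  exact OneEnded.isOneEndedSpanningForest_run hω
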